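/- Let $d\in\mathbb N$, let $\Delta=\{a_j\}_{j\in J}\subset\mathbb M_d$ be a finite family of self-adjoint matrices, $|\Delta|=|J|$ the number of jump operators, and $$L(x)=\sum_{j}\Big(a_jxa_j-\tfrac12(a_j^2x+xa_j^2)\Big),\qquad T_t=e^{tL}.$$ Put $\mathcal N=\mathbb M_d$, $\mathcal N_{fix}=\{x\in\mathbb M_d:[a_j,x]=0\ \forall j\}$, and let $E_{fix}$ be the trace-preserving conditional expectation of $\mathcal N$ onto $\mathcal N_{fix}$. All norms of matrices are operator norms. Define: (i) for a linear map $\Phi$ on $\mathbb M_d$ with dual $\Phi^*$ (that is, $\mathrm{tr}(\Phi^*(x)y)=\mathrm{tr}(x\Phi(y))$), the complete complexity $$C^{cb}_\Delta(\Phi)=\sup_{n\ge1}\ \sup\Big\{\|(id_n\otimes(\Phi^*-id))(X)\|:\ X\in\mathbb M_n(\mathbb M_d),\ (id_n\otimes E_{fix})(X)=0,\ \sup_j\|[I_n\otimes a_j,X]\|\le1\Big\};$$ (ii) $\|L\|_{cb}=\sup_{n\ge1}\|id_n\otimes L:\mathbb M_n(\mathbb M_d)\to\mathbb M_n(\mathbb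 M_d)\|$; (iii) $\mathrm{Ind}^{cb}(\mathcal N:\mathcal N_{fix})=\sup_{n\ge1}\inf\{\alpha>0:\rho\le\alpha\,(id_n\otimes E_{fix})(\rho)\ \text{for all } 0\le\rho\in\mathbb M_n(\mathbb M_d)\}$; (iv) $\mathrm{CLSI}(L)\in[0,\infty]$, the supremum of all $\lambda>0$ such that, for all $n\ge1$, $t\ge0$ and all density matrices $\rho\in\mathbb M_n(\mathbb M_d)$, $$D\big((id_n\otimes T_t)\rho\,\big\|\,(id_n\otimes E_{fix})\rho\big)\le e^{-\lambda t}D\big(\rho\,\big\|\,(id_n\otimes E_{fix})\rho\big),$$ where $D(\rho\|\sigma)=\mathrm{tr}(\rho(\log\rho-\log\sigma))$ if $\ker\sigma\subseteq\ker\rho$ and $D(\rho\|\sigma)=\infty$ otherwise (the supremum of the empty set being $0$). Then for every $t\ge0$ $$C^{cb}_\Delta(T_t)\le4\sqrt{\frac{2|\Delta|\log\mathrm{Ind}^{cb}(\mathcal N:\mathcal N_{fix})}{\mathrm{CLSI}(L)}}\;\|L\|_{cb}\,t ,$$ an inequality in $[0,\infty]$ with the conventions $c/\infty=0$, $c/0=\infty$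 for $c>0$, $0/0=0$ and $0\cdot\infty=0$ (and with the logarithm read as $0$ in the trivial case $d=0$). -/

import Mathlib

open scoped Matrix Kronecker ENNReal Matrix.Norms.L2Operator ComplexOrder

/- Throughout, `Matrix m m ℂ` carries the operator norm of `ℂᵐ` (scope `Matrix.Norms.L2Operator`),
and `M_n ⊗ M_d` is `Matrix (Fin n × Fin d) (Fin n × Fin d) ℂ`. Quantities that are suprema or
infima of nonnegative reals take values in `[0, ∞]`. -/

namespace QChannel

noncomputable section

/-- `M_d`, the algebra of complex `d × d` matrices. -/
abbrev Mat (d : ℕ) : Type := Matrix (Fin d) (Fin d) ℂ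

/-- `M_n ⊗ M_d = M_n(M_d)`. -/
abbrev MatAmp (n d : ℕ) : Type := Matrix (Fin n × Fin d) (Fin n × Fin d) ℂ

/-! ### Amplification, completely bounded norm, trace dual -/

/-- The amplification `id_n ⊗ Φ` of `Φ : M_d → M_d`: apply `Φ` to every `d × d` block. -/
def amp (n : ℕ) {d : ℕ} (Φ : Mat d →ₗ[ℂ] Mat d) : MatAmp n d →ₗ[ℂ] MatAmp n d where
  toFun X := Matrix.of fun p q => Φ (Matrix.of fun k l => X (p.1, k) (q.1, l)) p.2 q.2
  map_add' X Y := by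
    ext p q
    simp only [Matrix.of_apply, Matrix.add_apply]
    rw [← Matrix.add_apply, ← map_add]
    rfl
  map_smul' c X := by
    ext p q
    simp only [Matrix.of_apply, Matrix.smul_apply, RingHom.id_apply]
    rw [← Matrix.smul_apply, ← map_smul]
    rfl

theorem amp_kronecker (n : ℕ) {d : ℕ} (Φ : Mat d →ₗ[ℂ] Mat d) (A : Mat n) (B : Mat d) :
    amp n Φ (A ⊗ₖ B) = A ⊗ₖ Φ B := by
  ext p q
  have h : (Matrix.of fun k l => (A ⊗ₖ B) (p.1, k) (q.1, l)) = A p.1 q.1 • B := by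
    ext k l
    simp [Matrix.kroneckerMap_apply]
  change Φ (Matrix.of fun k l => (A ⊗ₖ B) (p.1, k) (q.1, l)) p.2 q.2 = _
  rw [h, map_smul]
  simp [Matrix.kroneckerMap_apply]

/-- `‖Φ‖_cb = sup_{n ≥ 1} ‖id_n ⊗ Φ : M_n(M_d) → M_n(M_d)‖`. -/
def cbNorm {d : ℕ} (Φ : Mat d →ₗ[ℂ] Mat d) : ℝ≥0∞ :=
  ⨆ (n : ℕ) (_ : 1 ≤ n) (X : MatAmp n d) (_ : ‖X‖ₑ ≤ 1), ‖amp n Φ X‖ₑ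

/-- The dual `Φ^*` of `Φ` under the trace pairing: `tr (Φ^*(x) y) = tr (x Φ(y))`. -/
def traceDual {d : ℕ} (Φ : Mat d →ₗ[ℂ] Mat d) : Mat d →ₗ[ℂ] Mat d where
  toFun x := Matrix.of fun i j => (x * Φ (Matrix.single j i 1)).trace
  map_add' x y := by
    ext i j
    simp [add_mul]
  map_smul' c x := by
    ext i j
    simp

theorem trace_traceDual_mul {d : ℕ} (Φ : Mat d →ₗ[ℂ] Mat d) (x y : Mat d) :
    (traceDual Φ x * y).trace = (x * Φ y).trace := by
  have hy : y = ∑ j, ∑ i, y j i • Matrix.single j i (1 : ℂ) := by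
    conv_lhs => rw [Matrix.matrix_eq_sum_single y]
    simp [Matrix.smul_single]
  conv_rhs => rw [hy]
  simp only [map_sum, map_smul, Finset.mul_sum, Matrix.trace_sum, Matrix.mul_smul,
    Matrix.trace_smul, smul_eq_mul]
  rw [Finset.sum_comm]
  simp [Matrix.trace, Matrix.mul_apply, traceDual, mul_comm]

/-! ### Commutant and trace-preserving conditional expectation -/

/-- The commutant `S' = {x ∈ M_d : [s, x] = 0 for all s ∈ S}`. -/
def commutant {d : ℕ} (S : Set (Mat d)) : Subalgebra ℂ (Mat d) :=
  Subalgebra.centralizer ℂ S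

/-- `M_d` as the Hilbert space with the Hilbert–Schmidt inner product `⟪x, y⟫ = tr (x^* y)`. -/
def toHS (d : ℕ) : Mat d ≃ₗ[ℂ] EuclideanSpace ℂ (Fin d × Fin d) where
  toFun x := WithLp.toLp 2 fun p => x p.1 p.2
  invFun v := Matrix.of fun i j => v (i, j)
  map_add' _ _ := rfl
  map_smul' _ _ := rfl
  left_inv _ := rfl
  right_inv _ := rfl

theorem inner_toHS {d : ℕ} (x y : Mat d) : inner ℂ (toHS d x) (toHS d y) = (xᴴ * y).trace := by
  simp only [PiLp.inner_apply, Matrix.trace, Matrix.diag, Matrix.mul_apply,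
    Matrix.conjTranspose_apply]
  rw [Fintype.sum_prod_type, Finset.sum_comm]
  simp only [RCLike.inner_apply, mul_comm]
  rfl

/-- The trace-preserving conditional expectation `E_M : M_d → M` onto a `*`-subalgebra `M`, that is,
the projection onto `M` orthogonal for the Hilbert–Schmidt inner product; it is characterized by
`condExp_mem` and `trace_condExp_mul` below. -/
def condExp {d : ℕ} (M : Subalgebra ℂ (Mat d)) : Mat d →ₗ[ℂ] Mat d :=
  (toHS d).symm.toLinearMap ∘ₗ
    (((Subalgebra.toSubmodule M).map (toHS d).toLinearMap).starProjection :
      EuclideanSpace ℂ (Fin d × Fin d) →ₗ[ℂ] EuclideanSpace ℂ (Fin d × Fin d)) ∘ₗ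
    (toHS d).toLinearMap

theorem condExp_mem {d : ℕ} (M : Subalgebra ℂ (Mat d)) (x : Mat d) : condExp M x ∈ M := by
  have h := Submodule.starProjection_apply_mem
    ((Subalgebra.toSubmodule M).map (toHS d).toLinearMap) (toHS d x)
  obtain ⟨y, hy, hyx⟩ := h
  have : condExp M x = y := by
    simp only [condExp, LinearMap.comp_apply, LinearEquiv.coe_coe, ContinuousLinearMap.coe_coe]
    rw [← hyx]
    simp
  rw [this]
  exact hy

/-- `tr (E_M(x) y) = tr (x y)` for all `y` in the `*`-subalgebra `M`. -/
theorem trace_condExp_mul {d : ℕ} (M : Subalgebra ℂ (Mat d)) (hM : ∀ y ∈ M, yᴴ ∈ M)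
    (x y : Mat d) (hy : y ∈ M) : (condExp M x * y).trace = (x * y).trace := by
  have h := Submodule.starProjection_inner_eq_zero
    (K := (Subalgebra.toSubmodule M).map (toHS d).toLinearMap) (toHS d x) (toHS d yᴴ)
    ⟨yᴴ, hM y hy, rfl⟩
  have hE : ((Subalgebra.toSubmodule M).map (toHS d).toLinearMap).starProjection (toHS d x)
      = toHS d (condExp M x) := by
    simp [condExp]
  rw [hE, ← map_sub, ← inner_conj_symm, inner_toHS] at h
  simp only [Matrix.conjTranspose_conjTranspose, map_eq_zero, mul_sub, Matrix.trace_sub,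
    sub_eq_zero] at h
  rw [Matrix.trace_mul_comm, ← h, Matrix.trace_mul_comm]

/-! ### Lipschitz norm and complete complexity of a channel -/

/-- The amplified Lipschitz norm `|||X|||_S^n = sup_{s ∈ S} ‖[I_n ⊗ s, X]‖`. -/
def lipNorm (n : ℕ) {d : ℕ} (S : Set (Mat d)) (X : MatAmp n d) : ℝ≥0∞ :=
  ⨆ s ∈ S, ‖((1 : Mat n) ⊗ₖ s) * X - X * ((1 : Mat n) ⊗ₖ s)‖ₑ

/-- The complete complexity
`C_S^cb(Φ) = sup_{n ≥ 1} ‖id_n ⊗ (Φ^* - id) : (M_n(A), |||·|||_S^n) → M_n(M_d)‖`, where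
`A = {x : E_{S'}(x) = 0}`. -/
def complexityCb {d : ℕ} (S : Set (Mat d)) (Φ : Mat d →ₗ[ℂ] Mat d) : ℝ≥0∞ :=
  ⨆ (n : ℕ) (_ : 1 ≤ n) (X : MatAmp n d) (_ : amp n (condExp (commutant S)) X = 0)
    (_ : lipNorm n S X ≤ 1), ‖amp n (traceDual Φ - LinearMap.id) X‖ₑ

/-! ### Symmetric Lindbladians -/

/-- `L(x) = ∑_j (a_j x a_j - ½ (a_j² x + x a_j²))`. -/
def lindbladian {d : ℕ} {ι : Type*} [Fintype ι] (a : ι → Mat d) : Mat d →ₗ[ℂ] Mat d where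
  toFun x := ∑ j, (a j * x * a j - (1 / 2 : ℂ) • (a j ^ 2 * x + x * a j ^ 2))
  map_add' x y := by
    rw [← Finset.sum_add_distrib]
    refine Finset.sum_congr rfl fun j _ => ?_
    simp only [mul_add, add_mul, smul_add]
    abel
  map_smul' c x := by
    simp only [RingHom.id_apply, Finset.smul_sum]
    refine Finset.sum_congr rfl fun j _ => ?_
    simp only [Matrix.mul_smul, Matrix.smul_mul, smul_sub, smul_add, smul_comm c]

/-- `e^{tf}` for an operator `f` on a finite-dimensional normed space, the exponential being taken in
the Banach algebra of bounded operators. -/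
def expEnd {E : Type*} [NormedAddCommGroup E] [NormedSpace ℂ E] [FiniteDimensional ℂ E]
    (f : E →ₗ[ℂ] E) (t : ℝ) : E →ₗ[ℂ] E :=
  (NormedSpace.exp ((t : ℂ) • LinearMap.toContinuousLinearMap f) : E →L[ℂ] E)

/-- `T_t = e^{tL}`. -/
def semigroup {d : ℕ} (L : Mat d →ₗ[ℂ] Mat d) (t : ℝ) : Mat d →ₗ[ℂ] Mat d :=
  expEnd L t

/-! ### Relative entropy and the complete modified logarithmic Sobolev constant -/

/-- A density matrix: positive semidefinite of trace one. -/
def IsState {m : Type*} [Fintype m] (ρ : Matrix m m ℂ) : Prop :=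
  ρ.PosSemidef ∧ ρ.trace = 1

open Classical in
/-- `D(ρ‖σ) = tr (ρ (log ρ - log σ))` if `ker σ ⊆ ker ρ`, and `∞` otherwise. The functional calculus
uses the convention `log 0 = 0`, so `log` is the logarithm on the support. -/
def relEntropy {m : Type*} [Fintype m] [DecidableEq m] (ρ σ : Matrix m m ℂ) : EReal :=
  if ∀ v : m → ℂ, σ *ᵥ v = 0 → ρ *ᵥ v = 0 then
    (((ρ * (cfc Real.log ρ - cfc Real.log σ)).trace.re : ℝ) : EReal)
  else ⊤

/-- The complete `r`-modified logarithmic Sobolev inequality of `T_t = e^{tL}` relative to the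
conditional expectation `E`: for all `n ≥ 1`, all `t ≥ 0` and all states `ρ` of `M_n ⊗ M_d`,
`D((id_n ⊗ T_t) ρ ‖ (id_n ⊗ E) ρ) ≤ e^{-rt} D(ρ ‖ (id_n ⊗ E) ρ)`. -/
def SatisfiesCLSI {d : ℕ} (L E : Mat d →ₗ[ℂ] Mat d) (r : ℝ) : Prop :=
  ∀ n : ℕ, 1 ≤ n → ∀ t : ℝ, 0 ≤ t → ∀ ρ : MatAmp n d, IsState ρ →
    relEntropy (amp n (semigroup L t) ρ) (amp n E ρ)
      ≤ ((Real.exp (-(r * t)) : ℝ) : EReal) * relEntropy ρ (amp n E ρ)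

/-- `CLSI(L)`: the best constant `r > 0` in the complete modified logarithmic Sobolev inequality
(`0` if there is none, `∞` if every `r` is admissible). -/
def clsi {d : ℕ} (L E : Mat d →ₗ[ℂ] Mat d) : ℝ≥0∞ :=
  ⨆ (r : ℝ) (_ : 0 < r) (_ : SatisfiesCLSI L E r), ENNReal.ofReal r

/-! ### Index -/

/-- `Ind^cb(M_d : M) = sup_{n ≥ 1} Ind(M_n(M_d) : M_n(M))`, where
`Ind = inf {α > 0 : ρ ≤ α E(ρ) for all ρ ≥ 0}` and the conditional expectation of `M_n(M_d)` onto
`M_n(M)` is `id_n ⊗ E_M`. -/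
def indexCb {d : ℕ} (M : Subalgebra ℂ (Mat d)) : ℝ≥0∞ :=
  ⨆ (n : ℕ) (_ : 1 ≤ n),
    ⨅ (α : ℝ) (_ : 0 < α)
      (_ : ∀ ρ : MatAmp n d, ρ.PosSemidef → ((α : ℂ) • amp n (condExp M) ρ - ρ).PosSemidef),
      ENNReal.ofReal α

end

end QChannel

open QChannel

/-!
Let `K = √(|Δ| log Ind / CLSI)`. It is enough to bound the operator norm of an element `X` of
`M_n(M_d)` with `E(X) = 0` and `‖[1 ⊗ a_j, X]‖ ≤ 1`: as `T_t` is a contraction on self-adjoint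
elements, `‖T_t X - X‖ ≤ t ‖L X‖ ≤ t ‖L‖_cb ‖X‖` for self-adjoint `X`, and `T_t` is its own trace
dual. The bound is `‖X‖ ≤ 2 K` for self-adjoint `X`; the real and imaginary parts of a general `X`
together give the factor `4`, which is smaller than the constant `4 √2` claimed.

The bound on `‖X‖` is a transport inequality, `|tr (X ρ)|² ≤ 4 |Δ| D(ρ‖Eρ) / r` for every invertible
state `ρ` and every admissible decay rate `r` (`sq_trace_mul_le_of_decay`), combined with
`D(ρ‖Eρ) ≤ log Ind`, which is operator monotonicity of the logarithm (`relEnt_le_log`). For the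
transport inequality, follow `tr (X ρ_s)` along `ρ_s = T_s ρ`. Integration by parts
(`trace_mul_lind`) turns the derivative `tr (X L ρ_s)` into `½ ∑ tr ([b_j, X] [b_j, ρ_s])` with
`b_j = 1 ⊗ a_j`. Since the logarithmic mean is at most the arithmetic mean, the trace norm of
`[b_j, ρ]` is controlled by `tr ([b_j, ρ]^* [b_j, log ρ])`
(`abs_trace_mul_commutator_le`), and these quantities add up to twice the entropy
production `-tr (L(ρ) log ρ)`. Hence `tr (X (ρ_s - ρ_{s+h}))²` is at most `|Δ| h / 2` times the
relative entropy lost over `[s, s + h]`, so at most `|Δ| h / 2` times `D(ρ_s‖Eρ)`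
(`trace_sub_expEnd_le`, `sq_trace_sub_expEnd_le`). With steps of length `2 / r` the exponential
decay makes the increments a geometric series, and `tr (X ρ_s)` tends to `tr (X E(ρ)) = 0` by a
quadratic refinement of Klein's inequality (`sq_dist_le_relEntropy`).

The entropy is never differentiated: Klein's inequality gives a one-sided first-order estimate over
short intervals with an error of second order, and such errors vanish under subdivision
(`le_of_quadratic_error`). The same device shows that `T_t` contracts the norm of self-adjoint
matrices (`norm_expEnd_lind_le`), the Euler step `1 + h L` being positive and unital up to `O(h²)`.
-/

namespace QTransport

open scoped MatrixOrder

/-! ### Traces in eigenbases and Klein's inequality -/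

section Spectral

variable {m : Type*} [Fintype m] [DecidableEq m]

/-- The matrix `U_A^* P U_B` of `P` in the eigenbases of two Hermitian matrices `A` and `B`, with
`U_A` and `U_B` their eigenvector unitaries. -/
noncomputable def eigCoord {A B : Matrix m m ℂ} (hA : A.IsHermitian) (hB : B.IsHermitian)
    (P : Matrix m m ℂ) : Matrix m m ℂ :=
  star (hA.eigenvectorUnitary : Matrix m m ℂ) * P * (hB.eigenvectorUnitary : Matrix m m ℂ)

theorem star_eigCoord {A B : Matrix m m ℂ} (hA : A.IsHermitian) (hB : B.IsHermitian)
    (P : Matrix m m ℂ) : star (eigCoord hA hB P) = eigCoord hB hA (star P) := by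
  simp [eigCoord, mul_assoc]

theorem trace_mul_cfc_mul_cfc {A B : Matrix m m ℂ} (hA : A.IsHermitian) (hB : B.IsHermitian)
    (P Q : Matrix m m ℂ) (f g : ℝ → ℝ) :
    (P * cfc f A * Q * cfc g B).trace =
      ∑ l, ∑ k, eigCoord hB hA P l k * (f (hA.eigenvalues k) : ℂ) *
        eigCoord hA hB Q k l * (g (hB.eigenvalues l) : ℂ) := by
  have h : (P * cfc f A * Q * cfc g B).trace =
      (eigCoord hB hA P * Matrix.diagonal (fun k => (f (hA.eigenvalues k) : ℂ)) *
        eigCoord hA hB Q * Matrix.diagonal (fun l => (g (hB.eigenvalues l) : ℂ))).trace := by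
    rw [hA.cfc_eq, hB.cfc_eq]
    simp only [Matrix.IsHermitian.cfc, Unitary.conjStarAlgAut_apply, eigCoord]
    rw [← mul_assoc, ← mul_assoc, Matrix.trace_mul_comm]
    simp only [mul_assoc]
    rfl
  rw [h]
  simp only [Matrix.trace, Matrix.diag]
  refine Finset.sum_congr rfl fun l _ => ?_
  rw [Matrix.mul_diagonal, Matrix.mul_apply, Finset.sum_mul]
  exact Finset.sum_congr rfl fun k _ => by rw [Matrix.mul_diagonal]

theorem continuousOn_spectrum (A : Matrix m m ℂ) (f : ℝ → ℝ) :
    ContinuousOn f (spectrum ℝ A) :=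
  (Matrix.finite_real_spectrum (A := A)).continuousOn f

theorem trace_cfc_mul_cfc_re {A B : Matrix m m ℂ} (hA : A.IsHermitian) (hB : B.IsHermitian)
    (f g : ℝ → ℝ) :
    (cfc f A * cfc g B).trace.re =
      ∑ l, ∑ k, ‖eigCoord hA hB 1 k l‖ ^ 2 *
        (f (hA.eigenvalues k) * g (hB.eigenvalues l)) := by
  have h := trace_mul_cfc_mul_cfc hA hB 1 1 f g
  rw [one_mul, mul_one] at h
  rw [h, Complex.re_sum]
  refine Finset.sum_congr rfl fun l _ => ?_
  rw [Complex.re_sum]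
  refine Finset.sum_congr rfl fun k _ => ?_
  have h1 : eigCoord hB hA 1 l k = star (eigCoord hA hB 1 k l) := by
    rw [← Matrix.star_apply, star_eigCoord, star_one]
  rw [h1]
  have h2 : star (eigCoord hA hB 1 k l) * eigCoord hA hB 1 k l
      = ((‖eigCoord hA hB 1 k l‖ ^ 2 : ℝ) : ℂ) := by
    rw [Complex.star_def, ← Complex.normSq_eq_conj_mul_self, Complex.normSq_eq_norm_sq]
  have h3 : star (eigCoord hA hB 1 k l) * (f (hA.eigenvalues k) : ℂ) * eigCoord hA hB 1 k l *
      (g (hB.eigenvalues l) : ℂ) = ((‖eigCoord hA hB 1 k l‖ ^ 2 *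
        (f (hA.eigenvalues k) * g (hB.eigenvalues l)) : ℝ) : ℂ) := by
    rw [Complex.ofReal_mul, ← h2]; push_cast; ring
  rw [h3, Complex.ofReal_re]

/-- The scalar inequality behind Klein's inequality. With `x = p²` and `y = q²` the right-hand side
is at least `(p - q)²`, by `log (q / p) ≤ q / p - 1`. -/
theorem klein_scalar {x y : ℝ} (hx : 0 < x) (hy : 0 < y) (hx1 : x ≤ 1) (hy1 : y ≤ 1) :
    (x - y) ^ 2 / 4 ≤ x * Real.log x - x * Real.log y - x + y := by
  obtain ⟨p, hp, rfl⟩ : ∃ p, 0 < p ∧ x = p ^ 2 :=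
    ⟨√x, Real.sqrt_pos.2 hx, (Real.sq_sqrt hx.le).symm⟩
  obtain ⟨q, hq, rfl⟩ : ∃ q, 0 < q ∧ y = q ^ 2 :=
    ⟨√y, Real.sqrt_pos.2 hy, (Real.sq_sqrt hy.le).symm⟩
  have h := Real.log_le_sub_one_of_pos (div_pos hq hp)
  rw [Real.log_div hq.ne' hp.ne'] at h
  rw [Real.log_pow, Real.log_pow]
  have h2 : p ^ 2 * (Real.log q - Real.log p) ≤ p * q - p ^ 2 := by
    calc p ^ 2 * (Real.log q - Real.log p) ≤ p ^ 2 * (q / p - 1) := by gcongr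
      _ = p * q - p ^ 2 := by field_simp
  have hp1 : p ≤ 1 := by nlinarith
  have hq1 : q ≤ 1 := by nlinarith
  have h3 : (p ^ 2 - q ^ 2) ^ 2 / 4 ≤ (p - q) ^ 2 := by
    have : (p ^ 2 - q ^ 2) ^ 2 = (p - q) ^ 2 * (p + q) ^ 2 := by ring
    rw [this]
    have : (p + q) ^ 2 ≤ 4 := by nlinarith
    nlinarith [sq_nonneg (p - q)]
  push_cast
  nlinarith

theorem eigenvalues_le_one_of_trace_eq_one {ρ : Matrix m m ℂ} (hρ : ρ.PosSemidef)
    (h1 : ρ.trace = 1) (k : m) : hρ.1.eigenvalues k ≤ 1 := by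
  have h := hρ.1.trace_eq_sum_eigenvalues
  rw [h1] at h
  have h' : (1 : ℝ) = ∑ i, hρ.1.eigenvalues i := by
    have := congrArg Complex.re h
    simpa using this
  rw [h']
  exact Finset.single_le_sum (fun i _ => hρ.eigenvalues_nonneg i) (Finset.mem_univ k)

/-- Klein's inequality with a quadratic remainder: the relative entropy of two invertible states
controls their squared Hilbert–Schmidt distance. -/
theorem sq_dist_le_relEntropy {ρ σ : Matrix m m ℂ} (hρ : ρ.PosDef) (hσ : σ.PosDef)
    (hρ1 : ρ.trace = 1) (hσ1 : σ.trace = 1) :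
    ((ρ - σ) * (ρ - σ)).trace.re / 4 ≤
      (ρ * (cfc Real.log ρ - cfc Real.log σ)).trace.re := by
  have hA := hρ.1
  have hB := hσ.1
  have iA : cfc (fun x : ℝ => x) ρ = ρ := cfc_id' ℝ ρ hA
  have iB : cfc (fun x : ℝ => x) σ = σ := cfc_id' ℝ σ hB
  have oA : cfc (fun _ : ℝ => (1 : ℝ)) ρ = 1 := cfc_const_one ℝ ρ hA
  have oB : cfc (fun _ : ℝ => (1 : ℝ)) σ = 1 := cfc_const_one ℝ σ hB
  have e1 : (ρ * cfc Real.log ρ).trace.re = (cfc (fun x => x * Real.log x) ρ *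
      cfc (fun _ : ℝ => (1 : ℝ)) σ).trace.re := by
    rw [cfc_mul (fun x : ℝ => x) Real.log ρ (continuousOn_spectrum _ _)
      (continuousOn_spectrum _ _), iA, oB, mul_one]
  have e2 : (ρ * cfc Real.log σ).trace.re = (cfc (fun x : ℝ => x) ρ *
      cfc Real.log σ).trace.re := by rw [iA]
  have e3 : (ρ * ρ).trace.re = (cfc (fun x : ℝ => x * x) ρ *
      cfc (fun _ : ℝ => (1 : ℝ)) σ).trace.re := by
    rw [cfc_mul (fun x : ℝ => x) (fun x => x) ρ (continuousOn_spectrum _ _)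
      (continuousOn_spectrum _ _), iA, oB, mul_one]
  have e4 : (σ * σ).trace.re = (cfc (fun _ : ℝ => (1 : ℝ)) ρ *
      cfc (fun x : ℝ => x * x) σ).trace.re := by
    rw [cfc_mul (fun x : ℝ => x) (fun x => x) σ (continuousOn_spectrum _ _)
      (continuousOn_spectrum _ _), iB, oA, one_mul]
  have e5 : (ρ * σ).trace.re = (cfc (fun x : ℝ => x) ρ *
      cfc (fun x : ℝ => x) σ).trace.re := by rw [iA, iB]
  have e6 : ρ.trace.re = (cfc (fun x : ℝ => x) ρ *
      cfc (fun _ : ℝ => (1 : ℝ)) σ).trace.re := by rw [iA, oB, mul_one]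
  have e7 : σ.trace.re = (cfc (fun _ : ℝ => (1 : ℝ)) ρ *
      cfc (fun x : ℝ => x) σ).trace.re := by rw [iB, oA, one_mul]
  have hsq : ((ρ - σ) * (ρ - σ)).trace.re
      = (ρ * ρ).trace.re - 2 * (ρ * σ).trace.re + (σ * σ).trace.re := by
    rw [mul_sub, sub_mul, sub_mul, Matrix.trace_sub, Matrix.trace_sub, Matrix.trace_sub,
      Matrix.trace_mul_comm σ ρ]
    simp only [Complex.sub_re]
    ring
  have hz : ρ.trace.re = σ.trace.re := by rw [hρ1, hσ1]
  rw [hsq, mul_sub, Matrix.trace_sub, Complex.sub_re]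
  suffices h : (0 : ℝ) ≤ (ρ * cfc Real.log ρ).trace.re - (ρ * cfc Real.log σ).trace.re
      - ρ.trace.re + σ.trace.re
      - ((ρ * ρ).trace.re - 2 * (ρ * σ).trace.re + (σ * σ).trace.re) / 4 by linarith
  rw [e1, e2, e3, e4, e5, e6, e7]
  simp only [trace_cfc_mul_cfc_re hA hB, Finset.mul_sum, ← Finset.sum_sub_distrib,
    ← Finset.sum_add_distrib, Finset.sum_div]
  refine Finset.sum_nonneg fun l _ => Finset.sum_nonneg fun k _ => ?_
  have h := klein_scalar (hρ.eigenvalues_pos k) (hσ.eigenvalues_pos l)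
    (eigenvalues_le_one_of_trace_eq_one hρ.posSemidef hρ1 k)
    (eigenvalues_le_one_of_trace_eq_one hσ.posSemidef hσ1 l)
  have h2 := mul_le_mul_of_nonneg_left h (sq_nonneg ‖eigCoord hA hB 1 k l‖)
  linarith

/-! ### Trace estimates -/

theorem norm_entry_le_opNorm (A : Matrix m m ℂ) (i j : m) : ‖A i j‖ ≤ ‖A‖ := by
  have h := Matrix.l2_opNorm_mulVec A (EuclideanSpace.single j (1 : ℂ))
  rw [PiLp.norm_single, norm_one, mul_one] at h
  refine le_trans ?_ h
  have h2 := PiLp.norm_apply_le (WithLp.toLp 2 (A *ᵥ (EuclideanSpace.single j (1 : ℂ)).ofLp)) i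
  refine le_trans (le_of_eq ?_) h2
  simp

theorem norm_trace_mul_le (A : Matrix m m ℂ) {ρ : Matrix m m ℂ} (hρ : ρ.PosSemidef) :
    ‖(A * ρ).trace‖ ≤ ‖A‖ * ρ.trace.re := by
  have hA := hρ.1
  set U : Matrix m m ℂ := (hA.eigenvectorUnitary : Matrix m m ℂ) with hU
  have hUn : ‖U‖ ≤ 1 := by
    cases isEmpty_or_nonempty m
    · simp [Subsingleton.elim U 0]
    · exact (CStarRing.norm_coe_unitary hA.eigenvectorUnitary).le
  have h : (A * ρ).trace = ∑ l, (star U * A * U) l l * (hA.eigenvalues l : ℂ) := by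
    conv_lhs => rw [hA.spectral_theorem]
    rw [Unitary.conjStarAlgAut_apply, ← mul_assoc, ← mul_assoc, Matrix.trace_mul_comm,
      ← mul_assoc, ← mul_assoc]
    simp only [Matrix.trace, Matrix.diag, Matrix.mul_diagonal]
    rfl
  have h2 : ρ.trace.re = ∑ l, hA.eigenvalues l := by
    rw [hA.trace_eq_sum_eigenvalues]; simp
  rw [h, h2, Finset.mul_sum]
  refine (norm_sum_le _ _).trans (Finset.sum_le_sum fun l _ => ?_)
  rw [norm_mul, Complex.norm_real, Real.norm_of_nonneg (hρ.eigenvalues_nonneg l)]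
  refine mul_le_mul_of_nonneg_right ((norm_entry_le_opNorm _ l l).trans ?_)
    (hρ.eigenvalues_nonneg l)
  calc ‖star U * A * U‖ ≤ ‖star U‖ * ‖A‖ * ‖U‖ :=
        (norm_mul_le _ _).trans (mul_le_mul_of_nonneg_right (norm_mul_le _ _) (norm_nonneg _))
    _ ≤ 1 * ‖A‖ * 1 := by rw [norm_star]; gcongr
    _ = ‖A‖ := by ring

theorem norm_trace_le (A : Matrix m m ℂ) : ‖A.trace‖ ≤ Fintype.card m * ‖A‖ := by
  have h := norm_trace_mul_le A (Matrix.PosSemidef.one (n := m) (R := ℂ))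
  rw [mul_one, Matrix.trace_one] at h
  simpa [mul_comm] using h

theorem trace_mul_nonneg {A B : Matrix m m ℂ} (hA : A.PosSemidef) (hB : B.PosSemidef) :
    0 ≤ (A * B).trace.re := by
  obtain ⟨C, rfl⟩ : ∃ C : Matrix m m ℂ, B = Cᴴ * C :=
    CStarAlgebra.nonneg_iff_eq_star_mul_self.mp hB.nonneg
  rw [← mul_assoc, Matrix.trace_mul_comm, ← mul_assoc]
  exact (Complex.le_def.1 (hA.mul_mul_conjTranspose_same C).trace_nonneg).1

/-! ### Commutators and entropy production -/

/-- The arithmetic mean dominates the logarithmic mean. -/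
theorem two_mul_sq_sub_le {x y : ℝ} (hx : 0 < x) (hy : 0 < y) :
    2 * (x - y) ^ 2 ≤ (x + y) * ((x - y) * (Real.log x - Real.log y)) := by
  wlog h : y ≤ x generalizing x y
  · have := this hy hx (le_of_not_ge h)
    nlinarith
  have h1 := Real.le_log_one_add_of_nonneg (x := x / y - 1)
    (by rw [sub_nonneg, le_div_iff₀ hy]; linarith)
  rw [add_sub_cancel, Real.log_div hx.ne' hy.ne'] at h1
  have h2 : 2 * (x / y - 1) / (x / y - 1 + 2) = 2 * (x - y) / (x + y) := by
    have : x / y - 1 + 2 = (x + y) / y := by field_simp; ring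
    rw [this]
    field_simp
  rw [h2, div_le_iff₀ (by positivity)] at h1
  nlinarith [mul_le_mul_of_nonneg_left h1 (sub_nonneg.2 h)]

theorem commutator_scalar {x y u v κ : ℝ} (hx : 0 < x) (hy : 0 < y) (hκ : 0 < κ) :
    |u * v * (x - y)| ≤ κ * (u ^ 2 * ((x + y) / 2)) +
      1 / (4 * κ) * (v ^ 2 * ((x - y) * (Real.log x - Real.log y))) := by
  have h := two_mul_sq_sub_le hx hy
  set P := (x - y) * (Real.log x - Real.log y)
  have hs : 0 < x + y := by positivity
  have hP : 2 * (x - y) ^ 2 / (x + y) ≤ P := by rw [div_le_iff₀ hs]; linarith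
  have h1 : κ * (u ^ 2 * ((x + y) / 2)) +
      1 / (4 * κ) * (v ^ 2 * (2 * (x - y) ^ 2 / (x + y))) ≤ κ * (u ^ 2 * ((x + y) / 2)) +
      1 / (4 * κ) * (v ^ 2 * P) := by gcongr
  refine le_trans ?_ h1
  have h2 : κ * (u ^ 2 * ((x + y) / 2)) + 1 / (4 * κ) * (v ^ 2 * (2 * (x - y) ^ 2 / (x + y)))
      = ((κ * (x + y) * u) ^ 2 + (v * (x - y)) ^ 2) / (2 * κ * (x + y)) := by
    field_simp
    ring
  rw [h2, le_div_iff₀ (by positivity), ← abs_of_pos (a := 2 * κ * (x + y)) (by positivity),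
    ← abs_mul, abs_le]
  constructor <;> nlinarith [sq_nonneg (κ * (x + y) * u - v * (x - y)),
    sq_nonneg (κ * (x + y) * u + v * (x - y))]

/-- The trace norm of a commutator `[b, ρ]` is controlled by the part
`tr ([b, ρ]^* [b, log ρ])` of the entropy production contributed by `b`. -/
theorem abs_trace_mul_commutator_le {ρ b Y : Matrix m m ℂ} (hρ : ρ.PosDef) (hb : b.IsHermitian)
    (hY : ‖Y‖ ≤ 1) {κ : ℝ} (hκ : 0 < κ) :
    |(Y * (b * ρ - ρ * b)).trace.re| ≤ κ * ρ.trace.re + 1 / (4 * κ) *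
      (2 * (b * b * (ρ * cfc Real.log ρ)).trace.re -
        2 * (b * ρ * b * cfc Real.log ρ).trace.re) := by
  have hA := hρ.1
  have iA : cfc (fun x : ℝ => x) ρ = ρ := cfc_id' ℝ ρ hA
  have oA : cfc (fun _ : ℝ => (1 : ℝ)) ρ = 1 := cfc_const_one ℝ ρ hA
  have lA : cfc (fun x => x * Real.log x) ρ = ρ * cfc Real.log ρ := by
    rw [cfc_mul (fun x : ℝ => x) Real.log ρ (continuousOn_spectrum _ _)
      (continuousOn_spectrum _ _), iA]
  set x := hA.eigenvalues with hx
  set y := eigCoord hA hA Y with hy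
  set c := eigCoord hA hA b with hc
  have hcs : ∀ k l, c l k = star (c k l) := fun k l => by
    rw [← Matrix.star_apply, hc, star_eigCoord, Matrix.star_eq_conjTranspose b, hb.eq]
  have hcc : ∀ k l, c l k * c k l = ((‖c k l‖ ^ 2 : ℝ) : ℂ) := fun k l => by
    rw [hcs, Complex.star_def, ← Complex.normSq_eq_conj_mul_self, Complex.normSq_eq_norm_sq]
  have key : ∀ f g : ℝ → ℝ, (b * cfc f ρ * b * cfc g ρ).trace.re =
      ∑ l, ∑ k, ‖c k l‖ ^ 2 * (f (x k) * g (x l)) := fun f g => by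
    rw [trace_mul_cfc_mul_cfc hA hA, Complex.re_sum]
    refine Finset.sum_congr rfl fun l _ => ?_
    rw [Complex.re_sum]
    refine Finset.sum_congr rfl fun k _ => ?_
    rw [← Complex.ofReal_re (‖c k l‖ ^ 2 * _), Complex.ofReal_mul, ← hcc]
    push_cast
    congr 1
    ring
  have e1 : (b * b * (ρ * cfc Real.log ρ)).trace.re =
      ∑ l, ∑ k, ‖c k l‖ ^ 2 * (x l * Real.log (x l)) := by
    have := key (fun _ => 1) (fun x => x * Real.log x)
    rw [oA, lA, mul_one] at this
    simpa only [one_mul] using this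
  have e1' : (b * b * (ρ * cfc Real.log ρ)).trace.re =
      ∑ l, ∑ k, ‖c k l‖ ^ 2 * (x k * Real.log (x k)) := by
    have := key (fun x => x * Real.log x) (fun _ => 1)
    rw [oA, lA, mul_one, Matrix.trace_mul_comm, ← mul_assoc] at this
    simpa only [mul_one] using this
  have e2 : (b * ρ * b * cfc Real.log ρ).trace.re =
      ∑ l, ∑ k, ‖c k l‖ ^ 2 * (x k * Real.log (x l)) := by
    have := key (fun x => x) Real.log
    rwa [iA] at this
  have e2' : (b * ρ * b * cfc Real.log ρ).trace.re =
      ∑ l, ∑ k, ‖c k l‖ ^ 2 * (Real.log (x k) * x l) := by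
    have := key Real.log (fun x => x)
    rw [iA, mul_assoc, Matrix.trace_mul_comm, ← mul_assoc] at this
    exact this
  -- Symmetrise in `k` and `l`.
  have eI : 2 * (b * b * (ρ * cfc Real.log ρ)).trace.re -
      2 * (b * ρ * b * cfc Real.log ρ).trace.re =
      ∑ l, ∑ k, ‖c k l‖ ^ 2 * ((x l - x k) * (Real.log (x l) - Real.log (x k))) := by
    have : ∀ p q : ℝ, 2 * p - 2 * q = p + p - (q + q) := fun p q => by ring
    rw [this]
    nth_rewrite 1 [e1]
    rw [e1']
    nth_rewrite 1 [e2]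
    rw [e2']
    simp only [← Finset.sum_sub_distrib, ← Finset.sum_add_distrib]
    refine Finset.sum_congr rfl fun l _ => Finset.sum_congr rfl fun k _ => ?_
    ring
  have eC : (Y * (b * ρ - ρ * b)).trace = ∑ l, ∑ k, y l k * c k l * ((x l - x k : ℝ) : ℂ) := by
    have h1 := trace_mul_cfc_mul_cfc hA hA Y b (fun _ => 1) (fun x => x)
    have h2 := trace_mul_cfc_mul_cfc hA hA Y b (fun x => x) (fun _ => 1)
    rw [iA, oA, mul_one] at h1 h2
    rw [mul_sub, Matrix.trace_sub, ← mul_assoc, ← mul_assoc, h1, h2]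
    simp only [← Finset.sum_sub_distrib]
    refine Finset.sum_congr rfl fun l _ => Finset.sum_congr rfl fun k _ => ?_
    push_cast
    ring
  have hyy : ∀ k l, y l k * star (y l k) = ((‖y l k‖ ^ 2 : ℝ) : ℂ) := fun k l => by
    rw [Complex.star_def, mul_comm, ← Complex.normSq_eq_conj_mul_self, Complex.normSq_eq_norm_sq]
  have keyY : ∀ f g : ℝ → ℝ, (Y * cfc f ρ * star Y * cfc g ρ).trace.re =
      ∑ l, ∑ k, ‖y l k‖ ^ 2 * (f (x k) * g (x l)) := fun f g => by
    rw [trace_mul_cfc_mul_cfc hA hA, Complex.re_sum]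
    refine Finset.sum_congr rfl fun l _ => ?_
    rw [Complex.re_sum]
    refine Finset.sum_congr rfl fun k _ => ?_
    rw [← Complex.ofReal_re (‖y l k‖ ^ 2 * _), Complex.ofReal_mul, ← hyy, ← Matrix.star_apply, hy,
      star_eigCoord]
    push_cast
    congr 1
    ring
  have hYY : ‖Y * star Y‖ ≤ 1 := (norm_mul_le _ _).trans (by
    rw [norm_star]; exact mul_le_one₀ hY (norm_nonneg _) hY)
  have hYY' : ‖star Y * Y‖ ≤ 1 := (norm_mul_le _ _).trans (by
    rw [norm_star]; exact mul_le_one₀ hY (norm_nonneg _) hY)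
  have htr : 0 ≤ ρ.trace.re := (Complex.le_def.1 hρ.posSemidef.trace_nonneg).1
  have y1 : ∑ l, ∑ k, ‖y l k‖ ^ 2 * x l ≤ ρ.trace.re := by
    have := keyY (fun _ => 1) (fun x => x)
    rw [iA, oA, mul_one] at this
    simp only [one_mul] at this
    rw [← this]
    exact ((Complex.re_le_norm _).trans (norm_trace_mul_le _ hρ.posSemidef)).trans
      (mul_le_of_le_one_left htr hYY)
  have y2 : ∑ l, ∑ k, ‖y l k‖ ^ 2 * x k ≤ ρ.trace.re := by
    have := keyY (fun x => x) (fun _ => 1)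
    rw [iA, oA, mul_one, Matrix.trace_mul_comm, ← mul_assoc] at this
    simp only [mul_one] at this
    rw [← this]
    exact ((Complex.re_le_norm _).trans (norm_trace_mul_le _ hρ.posSemidef)).trans
      (mul_le_of_le_one_left htr hYY')
  have y3 : ∑ l, ∑ k, ‖y l k‖ ^ 2 * ((x l + x k) / 2) ≤ ρ.trace.re := by
    have : ∑ l, ∑ k, ‖y l k‖ ^ 2 * ((x l + x k) / 2) =
        (∑ l, ∑ k, ‖y l k‖ ^ 2 * x l + ∑ l, ∑ k, ‖y l k‖ ^ 2 * x k) / 2 := by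
      simp only [← Finset.sum_add_distrib, Finset.sum_div]
      refine Finset.sum_congr rfl fun l _ => Finset.sum_congr rfl fun k _ => ?_
      ring
    rw [this]
    linarith
  rw [eI]
  refine le_trans ?_ (add_le_add_left (mul_le_mul_of_nonneg_left y3 hκ.le) _)
  refine (Complex.abs_re_le_norm _).trans ?_
  rw [eC]
  simp only [Finset.mul_sum, ← Finset.sum_add_distrib]
  refine (norm_sum_le _ _).trans (Finset.sum_le_sum fun l _ => ?_)
  refine (norm_sum_le _ _).trans (Finset.sum_le_sum fun k _ => ?_)
  refine le_trans (le_of_eq ?_) (commutator_scalar (u := ‖y l k‖) (v := ‖c k l‖)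
    (hρ.eigenvalues_pos l) (hρ.eigenvalues_pos k) hκ)
  rw [norm_mul, norm_mul, Complex.norm_real, abs_mul, abs_mul, abs_norm, abs_norm, Real.norm_eq_abs]

end Spectral

/-! ### One-parameter groups on finite-dimensional spaces -/

section Exp

variable {E F : Type*} [NormedAddCommGroup E] [NormedSpace ℂ E] [FiniteDimensional ℂ E]
  [NormedAddCommGroup F] [NormedSpace ℂ F] [FiniteDimensional ℂ F]

theorem hasSum_expEnd (f : E →ₗ[ℂ] E) (t : ℝ) (x : E) :
    HasSum (fun n : ℕ => ((n.factorial : ℂ)⁻¹ * (t : ℂ) ^ n) • (f ^ n) x) (expEnd f t x) := by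
  have := FiniteDimensional.complete ℂ E
  have h := NormedSpace.exp_series_hasSum_exp' (𝕂 := ℂ)
    ((t : ℂ) • LinearMap.toContinuousLinearMap f)
  have h2 := h.mapL (ContinuousLinearMap.apply ℂ E x)
  have : ∀ n : ℕ, ((LinearMap.toContinuousLinearMap f) ^ n) x = (f ^ n) x := fun n => by
    induction n with
    | zero => simp
    | succ k ih => rw [pow_succ', pow_succ', mul_apply_eq_comp, ih]; rfl
  convert h2 using 1
  on_goal 2 => rfl
  funext n
  rw [ContinuousLinearMap.apply_apply, smul_apply, smul_pow, smul_apply, this, mul_smul]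

theorem expEnd_zero (f : E →ₗ[ℂ] E) (x : E) : expEnd f 0 x = x := by
  simp [expEnd]

theorem expEnd_add (f : E →ₗ[ℂ] E) (s t : ℝ) (x : E) :
    expEnd f (s + t) x = expEnd f s (expEnd f t x) := by
  have := FiniteDimensional.complete ℂ E
  let _ : NormedAlgebra ℚ (E →L[ℂ] E) := NormedAlgebra.restrictScalars ℚ ℂ _
  have h := NormedSpace.exp_add_of_commute
    (x := (s : ℂ) • LinearMap.toContinuousLinearMap f)
    (y := (t : ℂ) • LinearMap.toContinuousLinearMap f)
    ((Commute.refl _).smul_left _ |>.smul_right _)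
  simp only [expEnd]
  push_cast
  rw [add_smul, h]
  rfl

theorem hasDerivAt_expEnd (f : E →ₗ[ℂ] E) (t : ℝ) (x : E) :
    HasDerivAt (fun s : ℝ => expEnd f s x) (expEnd f t (f x)) t := by
  have := FiniteDimensional.complete ℂ E
  have h := (hasDerivAt_exp_smul_const (LinearMap.toContinuousLinearMap f) (t : ℂ)).clm_apply
    (hasDerivAt_const (t : ℂ) x)
  exact (h.scomp t Complex.ofRealCLM.hasDerivAt).congr_deriv (by simp [expEnd])

theorem expEnd_of_apply_eq_zero {f : E →ₗ[ℂ] E} {x : E} (hx : f x = 0) (t : ℝ) :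
    expEnd f t x = x := by
  refine (hasSum_expEnd f t x).unique ?_
  convert hasSum_single (f := fun n : ℕ => ((n.factorial : ℂ)⁻¹ * (t : ℂ) ^ n) • (f ^ n) x) 0 ?_
    using 1
  · simp
  · intro n hn
    obtain ⟨k, rfl⟩ := Nat.exists_eq_succ_of_ne_zero hn
    simp [pow_succ, hx]

theorem expEnd_intertwine {f : E →ₗ[ℂ] E} {g : F →ₗ[ℂ] F} (φ : E →ₗ[ℂ] F)
    (h : ∀ x, g (φ x) = φ (f x)) (t : ℝ) (x : E) : expEnd g t (φ x) = φ (expEnd f t x) := by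
  have h1 := (hasSum_expEnd f t x).mapL (LinearMap.toContinuousLinearMap φ)
  have hn : ∀ (n : ℕ) x, (g ^ n) (φ x) = φ ((f ^ n) x) := fun n => by
    induction n with
    | zero => simp
    | succ k ih =>
      intro x
      simp only [pow_succ, Module.End.mul_apply]
      rw [h, ih]
  refine HasSum.unique ?_ h1
  convert hasSum_expEnd g t (φ x) using 2 with n
  rw [map_smul]
  congr 1
  exact (hn n x).symm

/-- An operator that is symmetric for a bilinear form generates a symmetric one-parameter group. -/
theorem expEnd_symmetric {f : E →ₗ[ℂ] E} (B : E →ₗ[ℂ] E →ₗ[ℂ] ℂ)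
    (h : ∀ x y, B (f x) y = B x (f y)) (t : ℝ) (x y : E) :
    B (expEnd f t x) y = B x (expEnd f t y) := by
  have h1 := (hasSum_expEnd f t x).mapL (LinearMap.toContinuousLinearMap (B.flip y))
  have h2 := (hasSum_expEnd f t y).mapL (LinearMap.toContinuousLinearMap (B x))
  refine h1.unique ?_
  have hn : ∀ n x, B ((f ^ n) x) y = B x ((f ^ n) y) := fun n => by
    induction n with
    | zero => simp
    | succ k ih =>
      intro x
      rw [pow_succ, Module.End.mul_apply, ih, h, ← Module.End.mul_apply, ← pow_succ', pow_succ]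
  convert h2 using 1
  on_goal 2 => rfl
  funext n
  simp [hn]

theorem norm_exp_sub_one_sub_le {𝔸 : Type*} [NormedRing 𝔸] [NormedAlgebra ℂ 𝔸] [CompleteSpace 𝔸]
    (z : 𝔸) : ‖NormedSpace.exp z - 1 - z‖ ≤ ‖z‖ ^ 2 * Real.exp ‖z‖ := by
  have h := NormedSpace.exp_series_hasSum_exp' (𝕂 := ℂ) z
  have h2 := (hasSum_nat_add_iff' 2).2 h
  have h3 : NormedSpace.exp z - ∑ i ∈ Finset.range 2, ((i.factorial : ℂ)⁻¹) • z ^ i =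
      NormedSpace.exp z - 1 - z := by
    simp [Finset.sum_range_succ, sub_sub]
  rw [h3] at h2
  have h4 : HasSum (fun n : ℕ => ‖z‖ ^ 2 * (((n.factorial : ℝ)⁻¹) • ‖z‖ ^ n))
      (‖z‖ ^ 2 * Real.exp ‖z‖) := by
    rw [Real.exp_eq_exp_ℝ]
    exact (NormedSpace.exp_series_hasSum_exp' (𝕂 := ℝ) ‖z‖).mul_left _
  rw [← h2.tsum_eq]
  refine tsum_of_norm_bounded h4 fun n => ?_
  rw [norm_smul, norm_inv, smul_eq_mul, Complex.norm_natCast]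
  have h5 : ‖z ^ (n + 2)‖ ≤ ‖z‖ ^ (n + 2) := norm_pow_le' z (by omega)
  have h6 : (((n + 2).factorial : ℝ))⁻¹ ≤ ((n.factorial : ℝ))⁻¹ := by
    gcongr
    omega
  calc (((n + 2).factorial : ℝ))⁻¹ * ‖z ^ (n + 2)‖
      ≤ ((n.factorial : ℝ))⁻¹ * ‖z‖ ^ (n + 2) := by gcongr
    _ = _ := by ring

theorem exists_norm_expEnd_sub_le (f : E →ₗ[ℂ] E) (t : ℝ) :
    ∃ C, 0 ≤ C ∧ ∀ h : ℝ, |h| ≤ t → ∀ x,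
      ‖expEnd f h x - x - (h : ℂ) • f x‖ ≤ C * h ^ 2 * ‖x‖ := by
  have := FiniteDimensional.complete ℂ E
  set A := LinearMap.toContinuousLinearMap f
  refine ⟨‖A‖ ^ 2 * Real.exp (t * ‖A‖), by positivity, fun h hh x => ?_⟩
  have h1 := norm_exp_sub_one_sub_le ((h : ℂ) • A)
  have h2 : ‖(h : ℂ) • A‖ = |h| * ‖A‖ := by rw [norm_smul, Complex.norm_real, Real.norm_eq_abs]
  rw [h2] at h1
  have h3 : expEnd f h x - x - (h : ℂ) • f x =
      (NormedSpace.exp ((h : ℂ) • A) - 1 - (h : ℂ) • A) x := by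
    simp [expEnd, A]
  rw [h3]
  refine (ContinuousLinearMap.le_opNorm _ x).trans (mul_le_mul_of_nonneg_right ?_ (norm_nonneg x))
  refine h1.trans ?_
  rw [mul_pow, sq_abs]
  have : Real.exp (|h| * ‖A‖) ≤ Real.exp (t * ‖A‖) := by gcongr
  calc h ^ 2 * ‖A‖ ^ 2 * Real.exp (|h| * ‖A‖) ≤ h ^ 2 * ‖A‖ ^ 2 * Real.exp (t * ‖A‖) := by gcongr
    _ = _ := by ring

theorem exists_norm_expEnd_le (f : E →ₗ[ℂ] E) (t : ℝ) :
    ∃ C, 0 ≤ C ∧ ∀ h : ℝ, |h| ≤ t → ∀ x, ‖expEnd f h x‖ ≤ C * ‖x‖ := by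
  obtain ⟨C, hC, H⟩ := exists_norm_expEnd_sub_le f t
  set A := LinearMap.toContinuousLinearMap f
  refine ⟨C * t ^ 2 + 1 + |t| * ‖A‖, by positivity, fun h hh x => ?_⟩
  have h1 := H h hh x
  have h2 : ‖(h : ℂ) • f x‖ ≤ |t| * ‖A‖ * ‖x‖ := by
    rw [norm_smul, Complex.norm_real, Real.norm_eq_abs, mul_assoc]
    exact mul_le_mul (hh.trans (le_abs_self t)) (A.le_opNorm x) (norm_nonneg _) (abs_nonneg _)
  have h3 : expEnd f h x = (expEnd f h x - x - (h : ℂ) • f x) + x + (h : ℂ) • f x := by abel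
  have h4 : h ^ 2 ≤ t ^ 2 := sq_le_sq.2 (hh.trans (le_abs_self t))
  rw [h3]
  calc _ ≤ ‖expEnd f h x - x - (h : ℂ) • f x‖ + ‖x‖ + ‖(h : ℂ) • f x‖ := norm_add₃_le
    _ ≤ C * t ^ 2 * ‖x‖ + ‖x‖ + |t| * ‖A‖ * ‖x‖ := by
        gcongr
        exact h1.trans (by gcongr)
    _ = _ := by ring

/-- A function which decreases over every interval of length `h` by at most `C h²` is monotone. -/
theorem le_of_quadratic_error {G : ℝ → ℝ} {t C : ℝ} (ht : 0 ≤ t)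
    (hG : ∀ s h, 0 ≤ s → 0 ≤ h → s + h ≤ t → G s - C * h ^ 2 ≤ G (s + h)) : G 0 ≤ G t := by
  have key : ∀ N : ℕ, G 0 - C * t ^ 2 * (1 / ((N : ℝ) + 1)) ≤ G t := fun N => by
    have hN : (0 : ℝ) < (N : ℝ) + 1 := by positivity
    have h0 : 0 ≤ t / ((N : ℝ) + 1) := by positivity
    have ind : ∀ k : ℕ, k ≤ N + 1 →
        G 0 - k * (C * (t / ((N : ℝ) + 1)) ^ 2) ≤ G (k * (t / ((N : ℝ) + 1))) := fun k => by
      induction k with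
      | zero => simp
      | succ k ih =>
        intro hk
        have h1 := ih (by omega)
        have hk' : (k : ℝ) + 1 ≤ (N : ℝ) + 1 := by exact_mod_cast hk
        have h2 := hG (k * (t / ((N : ℝ) + 1))) (t / ((N : ℝ) + 1)) (by positivity) h0 (by
          calc (k : ℝ) * (t / ((N : ℝ) + 1)) + t / ((N : ℝ) + 1)
              = ((k : ℝ) + 1) * (t / ((N : ℝ) + 1)) := by ring
            _ ≤ ((N : ℝ) + 1) * (t / ((N : ℝ) + 1)) := by gcongr
            _ = t := by field_simp)
        have h3 : ((k + 1 : ℕ) : ℝ) * (t / ((N : ℝ) + 1)) =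
            k * (t / ((N : ℝ) + 1)) + t / ((N : ℝ) + 1) := by push_cast; ring
        rw [h3]
        push_cast
        linarith
    have h := ind (N + 1) le_rfl
    have h4 : ((N + 1 : ℕ) : ℝ) * (t / ((N : ℝ) + 1)) = t := by push_cast; field_simp
    rw [h4] at h
    refine le_trans (le_of_eq ?_) h
    push_cast
    field_simp
  refine le_of_tendsto_of_tendsto' (b := Filter.atTop)
    (f := fun N : ℕ => G 0 - C * t ^ 2 * (1 / ((N : ℝ) + 1))) (g := fun _ => G t)
    ?_ tendsto_const_nhds key
  have := (tendsto_one_div_add_atTop_nhds_zero_nat (𝕜 := ℝ)).const_mul (C * t ^ 2)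
  simpa using tendsto_const_nhds.sub this

end Exp

/-! ### Symmetric Lindbladians -/

section Lindblad

variable {m : Type*} [Fintype m] [DecidableEq m] {ι : Type*} [Fintype ι]

/-- The symmetric Lindbladian `x ↦ ∑_j (b_j x b_j - ½ (b_j² x + x b_j²))` on matrices over an
arbitrary finite index type. -/
noncomputable def lind (b : ι → Matrix m m ℂ) : Matrix m m ℂ →ₗ[ℂ] Matrix m m ℂ where
  toFun x := ∑ j, (b j * x * b j - (1 / 2 : ℂ) • (b j ^ 2 * x + x * b j ^ 2))
  map_add' x y := by
    rw [← Finset.sum_add_distrib]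
    refine Finset.sum_congr rfl fun j _ => ?_
    simp only [mul_add, add_mul, smul_add]
    abel
  map_smul' c x := by
    simp only [RingHom.id_apply, Finset.smul_sum]
    refine Finset.sum_congr rfl fun j _ => ?_
    simp only [Matrix.mul_smul, Matrix.smul_mul, smul_sub, smul_add, smul_comm c]

variable {b : ι → Matrix m m ℂ}

theorem lind_apply (b : ι → Matrix m m ℂ) (x : Matrix m m ℂ) :
    lind b x = ∑ j, (b j * x * b j - (1 / 2 : ℂ) • (b j ^ 2 * x + x * b j ^ 2)) := rfl

theorem lind_of_commute {x : Matrix m m ℂ} (h : ∀ j, Commute (b j) x) : lind b x = 0 := by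
  rw [lind_apply]
  refine Finset.sum_eq_zero fun j _ => ?_
  have h1 : b j ^ 2 * x = x * b j ^ 2 := (h j).pow_left 2
  rw [h1, (h j).eq, mul_assoc, ← sq, ← two_smul ℂ (x * b j ^ 2), smul_smul]
  norm_num

theorem trace_lind_mul (b : ι → Matrix m m ℂ) (x y : Matrix m m ℂ) :
    (lind b x * y).trace = (x * lind b y).trace := by
  simp only [lind_apply, Finset.sum_mul, Finset.mul_sum, Matrix.trace_sum]
  refine Finset.sum_congr rfl fun j _ => ?_
  simp only [sub_mul, mul_sub, smul_mul_assoc, mul_smul_comm, add_mul, mul_add, Matrix.trace_sub,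
    Matrix.trace_smul, Matrix.trace_add]
  have h1 : (b j * x * b j * y).trace = (x * (b j * y * b j)).trace := by
    rw [mul_assoc, mul_assoc, Matrix.trace_mul_comm]; simp only [mul_assoc]
  have h2 : (b j ^ 2 * x * y).trace = (x * (y * b j ^ 2)).trace := by
    rw [mul_assoc, Matrix.trace_mul_comm, mul_assoc]
  have h3 : (x * b j ^ 2 * y).trace = (x * (b j ^ 2 * y)).trace := by rw [mul_assoc]
  rw [h1, h2, h3]
  ring

theorem lind_star (hb : ∀ j, (b j).IsHermitian) (x : Matrix m m ℂ) :
    lind b (star x) = star (lind b x) := by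
  have hs : ∀ j, star (b j) = b j := fun j => hb j
  simp only [lind_apply, star_sum]
  refine Finset.sum_congr rfl fun j _ => ?_
  simp only [star_sub, star_mul, star_smul, star_add, star_pow, hs, mul_assoc, add_comm]
  simp

/-- The semigroup generated by a symmetric Lindbladian is symmetric for the trace pairing. -/
theorem trace_expEnd_lind_mul (b : ι → Matrix m m ℂ) (t : ℝ) (x y : Matrix m m ℂ) :
    (expEnd (lind b) t x * y).trace = (x * expEnd (lind b) t y).trace := by
  have := expEnd_symmetric (f := lind b)
    (LinearMap.mk₂ ℂ (fun x y : Matrix m m ℂ => (x * y).trace)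
      (fun a b c => by simp [add_mul]) (fun a b c => by simp)
      (fun a b c => by simp [mul_add]) (fun a b c => by simp))
    (fun x y => trace_lind_mul b x y) t x y
  simpa using this

theorem expEnd_lind_of_commute {x : Matrix m m ℂ} (h : ∀ j, Commute (b j) x) (t : ℝ) :
    expEnd (lind b) t x = x :=
  expEnd_of_apply_eq_zero (lind_of_commute h) t

theorem trace_expEnd_lind (b : ι → Matrix m m ℂ) (t : ℝ) (x : Matrix m m ℂ) :
    (expEnd (lind b) t x).trace = x.trace := by
  have := trace_expEnd_lind_mul b t x 1
  rwa [expEnd_lind_of_commute (x := 1) (fun j => Commute.one_right _), mul_one, mul_one] at this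

theorem expEnd_lind_star (hb : ∀ j, (b j).IsHermitian) (t : ℝ) (x : Matrix m m ℂ) :
    expEnd (lind b) t (star x) = star (expEnd (lind b) t x) := by
  refine (hasSum_expEnd (lind b) t (star x)).unique ?_
  convert (hasSum_expEnd (lind b) t x).star using 2 with n
  have hn : ∀ x, ((lind b) ^ n) (star x) = star (((lind b) ^ n) x) := by
    induction n with
    | zero => simp
    | succ k ih =>
      intro x
      simp only [pow_succ, Module.End.mul_apply]
      rw [lind_star hb, ih]
  rw [hn, star_smul]
  congr 1
  simp

theorem isSelfAdjoint_expEnd_lind (hb : ∀ j, (b j).IsHermitian) (t : ℝ) {x : Matrix m m ℂ}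
    (hx : IsSelfAdjoint x) : IsSelfAdjoint (expEnd (lind b) t x) := by
  rw [isSelfAdjoint_iff, ← expEnd_lind_star hb, hx.star_eq]

theorem norm_le_of_neg_le_of_le {x : Matrix m m ℂ} (hx : IsSelfAdjoint x) {r : ℝ}
    (hr : 0 ≤ r) (h1 : -algebraMap ℝ (Matrix m m ℂ) r ≤ x)
    (h2 : x ≤ algebraMap ℝ (Matrix m m ℂ) r) : ‖x‖ ≤ r := by
  cases isEmpty_or_nonempty m
  · simpa [Subsingleton.elim x 0] using hr
  rw [le_algebraMap_iff_spectrum_le hx] at h2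
  rw [← map_neg, algebraMap_le_iff_le_spectrum hx] at h1
  rcases CStarAlgebra.norm_or_neg_norm_mem_spectrum hx with h | h
  · exact h2 _ h
  · linarith [h1 _ h]

/-- The explicit Euler step `1 + h L` of a symmetric Lindbladian expands the norm of a self-adjoint
matrix at most by a factor `1 + O(h²)`, since it agrees up to `O(h²)` with the positive map
`x ↦ (1 - h G) x (1 - h G) + h ∑ b_j x b_j`, where `G = ½ ∑ b_j²`. -/
theorem exists_norm_add_smul_lind_le (hb : ∀ j, (b j).IsHermitian) :
    ∃ C, 0 ≤ C ∧ ∀ h : ℝ, 0 ≤ h → ∀ x : Matrix m m ℂ, IsSelfAdjoint x →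
      ‖x + (h : ℂ) • lind b x‖ ≤ ‖x‖ + C * h ^ 2 * ‖x‖ := by
  obtain ⟨G, hG⟩ : ∃ G : Matrix m m ℂ, G = (1 / 2 : ℂ) • ∑ j, b j ^ 2 := ⟨_, rfl⟩
  have hs : ∀ j, star (b j) = b j := fun j => hb j
  have hGs : star G = G := by
    simp [hG, star_smul, star_sum, hs]
  set S : ℝ → Matrix m m ℂ → Matrix m m ℂ := fun h x =>
    (1 - (h : ℂ) • G) * x * star (1 - (h : ℂ) • G) + h • ∑ j, b j * x * star (b j) with hS
  have hLG : ∀ x, lind b x = ∑ j, b j * x * b j - (G * x + x * G) := fun x => by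
    rw [lind_apply, Finset.sum_sub_distrib, ← Finset.smul_sum, Finset.sum_add_distrib,
      ← Finset.sum_mul, ← Finset.mul_sum, hG, smul_add, smul_mul_assoc, mul_smul_comm]
  have hSL : ∀ (h : ℝ) x, S h x = x + (h : ℂ) • lind b x + ((h : ℂ) ^ 2) • (G * x * G) := by
    intro h x
    have hst : star (1 - (h : ℂ) • G) = 1 - (h : ℂ) • G := by
      rw [star_sub, star_one, star_smul, hGs]; simp
    simp only [hS, hst, hs, hLG]
    have : h • ∑ j, b j * x * b j = (h : ℂ) • ∑ j, b j * x * b j := by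
      rw [Complex.coe_smul]
    rw [this]
    simp only [sub_mul, mul_sub, one_mul, mul_one, smul_mul_assoc, mul_smul_comm, smul_sub,
      smul_add, smul_smul, ← sq]
    abel
  have hmono : ∀ h : ℝ, 0 ≤ h → ∀ x y, x ≤ y → S h x ≤ S h y := fun h hh x y hxy => by
    refine add_le_add (star_right_conjugate_le_conjugate hxy _)
      (smul_le_smul_of_nonneg_left (Finset.sum_le_sum fun j _ =>
        star_right_conjugate_le_conjugate hxy _) hh)
  have hlin : ∀ (h r : ℝ), S h (algebraMap ℝ _ r) = r • S h 1 := fun h r => by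
    simp only [hS, Algebra.algebraMap_eq_smul_one, mul_smul_comm, smul_mul_assoc, smul_add,
      ← Finset.smul_sum]
    rw [smul_comm h r]
  have hneg : ∀ (h : ℝ) x, S h (-x) = - S h x := fun h x => by
    simp only [hS, mul_neg, neg_mul, Finset.sum_neg_distrib, smul_neg, neg_add]
  have hone : ∀ h : ℝ, S h 1 = 1 + ((h : ℂ) ^ 2) • (G * G) := fun h => by
    rw [hSL, lind_of_commute (x := 1) fun j => Commute.one_right _]
    simp
  have hle : ∀ h r : ℝ, 0 ≤ r → S h (algebraMap ℝ _ r) ≤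
      algebraMap ℝ (Matrix m m ℂ) (r * (1 + h ^ 2 * ‖G * G‖)) := fun h r hr => by
    have h1 : G * G ≤ algebraMap ℝ _ ‖G * G‖ :=
      IsSelfAdjoint.le_algebraMap_norm_self (by rw [isSelfAdjoint_iff, star_mul, hGs])
    have h2 : ((h : ℂ) ^ 2) • (G * G) = (h ^ 2) • (G * G) := by
      rw [← Complex.ofReal_pow, Complex.coe_smul]
    rw [hlin, hone, h2, map_mul, Algebra.algebraMap_eq_smul_one r, smul_mul_assoc, one_mul,
      map_add, map_one, map_mul, Algebra.algebraMap_eq_smul_one (h ^ 2), smul_mul_assoc, one_mul]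
    exact smul_le_smul_of_nonneg_left (by gcongr) hr
  refine ⟨‖G * G‖ + ‖G‖ * ‖G‖, by positivity, fun h hh x hx => ?_⟩
  have hSx : IsSelfAdjoint (S h x) := by
    rw [isSelfAdjoint_iff]
    simp only [hS, star_add, star_mul, star_star, star_smul, star_sum, hx.star_eq, mul_assoc,
      star_trivial]
  have hb1 : ‖S h x‖ ≤ ‖x‖ * (1 + h ^ 2 * ‖G * G‖) := by
    refine norm_le_of_neg_le_of_le hSx (by positivity) ?_ ?_
    · refine le_trans (neg_le_neg (hle h ‖x‖ (norm_nonneg x))) ?_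
      rw [← hneg]
      exact hmono h hh _ _ hx.neg_algebraMap_norm_le_self
    · exact (hmono h hh _ _ hx.le_algebraMap_norm_self).trans (hle h ‖x‖ (norm_nonneg x))
  have hb2 : ‖((h : ℂ) ^ 2) • (G * x * G)‖ ≤ h ^ 2 * (‖G‖ * ‖x‖ * ‖G‖) := by
    rw [norm_smul, norm_pow, Complex.norm_real, Real.norm_eq_abs, sq_abs]
    gcongr
    exact (norm_mul_le _ _).trans (by gcongr; exact norm_mul_le _ _)
  have hx' : x + (h : ℂ) • lind b x = S h x - ((h : ℂ) ^ 2) • (G * x * G) := by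
    rw [hSL]; abel
  rw [hx']
  refine (norm_sub_le _ _).trans ((add_le_add hb1 hb2).trans (le_of_eq ?_))
  ring

/-- A symmetric Lindbladian generates a semigroup of contractions for the operator norm on
self-adjoint matrices. -/
theorem norm_expEnd_lind_le (hb : ∀ j, (b j).IsHermitian) {t : ℝ} (ht : 0 ≤ t) {x : Matrix m m ℂ}
    (hx : IsSelfAdjoint x) : ‖expEnd (lind b) t x‖ ≤ ‖x‖ := by
  obtain ⟨C₁, hC₁, H₁⟩ := exists_norm_expEnd_sub_le (lind b) t
  obtain ⟨C₂, hC₂, H₂⟩ := exists_norm_expEnd_le (lind b) t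
  obtain ⟨C₃, hC₃, H₃⟩ := exists_norm_add_smul_lind_le hb
  have h := le_of_quadratic_error (G := fun s => -‖expEnd (lind b) s x‖)
    (C := (C₁ + C₃) * (C₂ * ‖x‖)) ht ?_
  · simp only [expEnd_zero] at h
    linarith
  intro s h hs hh hsh
  have hys := isSelfAdjoint_expEnd_lind hb s hx
  set y := expEnd (lind b) s x with hy
  have h1 := H₁ h (by rw [abs_of_nonneg hh]; linarith) y
  have h2 : ‖y‖ ≤ C₂ * ‖x‖ := H₂ s (by rw [abs_of_nonneg hs]; linarith) x
  have h3 := H₃ h hh y hys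
  have h4 : expEnd (lind b) (s + h) x = (expEnd (lind b) h y - y - (h : ℂ) • lind b y)
      + (y + (h : ℂ) • lind b y) := by
    rw [add_comm s h, expEnd_add]; abel
  have h5 : ‖expEnd (lind b) (s + h) x‖ ≤ C₁ * h ^ 2 * ‖y‖ + (‖y‖ + C₃ * h ^ 2 * ‖y‖) := by
    rw [h4]; exact (norm_add_le _ _).trans (add_le_add h1 h3)
  have h6 : (C₁ + C₃) * h ^ 2 * ‖y‖ ≤ (C₁ + C₃) * h ^ 2 * (C₂ * ‖x‖) := by gcongr
  linarith

theorem expEnd_lind_algebraMap (b : ι → Matrix m m ℂ) (t r : ℝ) :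
    expEnd (lind b) t (algebraMap ℝ _ r) = algebraMap ℝ _ r :=
  expEnd_lind_of_commute (fun j => (Algebra.commutes r (b j)).symm) t

/-- Positivity is the contraction property applied to `x - ‖x‖`. -/
theorem expEnd_lind_nonneg (hb : ∀ j, (b j).IsHermitian) {t : ℝ} (ht : 0 ≤ t) {x : Matrix m m ℂ}
    (hx : 0 ≤ x) : 0 ≤ expEnd (lind b) t x := by
  have hxs : IsSelfAdjoint x := IsSelfAdjoint.of_nonneg hx
  have hrs : IsSelfAdjoint (algebraMap ℝ (Matrix m m ℂ) ‖x‖) := IsSelfAdjoint.algebraMap _ (.all _)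
  have h1 : ‖x - algebraMap ℝ _ ‖x‖‖ ≤ ‖x‖ := by
    refine norm_le_of_neg_le_of_le (hxs.sub hrs) (norm_nonneg x) ?_ ?_
    · rw [neg_le_sub_iff_le_add]
      simpa using hx
    · rw [sub_le_iff_le_add]
      refine hxs.le_algebraMap_norm_self.trans (le_add_of_nonneg_right ?_)
      exact algebraMap_nonneg _ (norm_nonneg x)
  have h2 := (norm_expEnd_lind_le hb ht (hxs.sub hrs)).trans h1
  rw [map_sub, expEnd_lind_algebraMap] at h2
  set y := expEnd (lind b) t x - algebraMap ℝ _ ‖x‖ with hy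
  have hys : IsSelfAdjoint y := (isSelfAdjoint_expEnd_lind hb t hxs).sub hrs
  have h3 : -algebraMap ℝ _ ‖x‖ ≤ y :=
    (neg_le_neg (algebraMap_mono _ h2)).trans hys.neg_algebraMap_norm_le_self
  rw [hy, neg_le_sub_iff_le_add] at h3
  simpa using h3

theorem algebraMap_le_expEnd_lind (hb : ∀ j, (b j).IsHermitian) {t c : ℝ} (ht : 0 ≤ t)
    {x : Matrix m m ℂ} (hx : algebraMap ℝ _ c ≤ x) :
    algebraMap ℝ _ c ≤ expEnd (lind b) t x := by
  have := expEnd_lind_nonneg hb ht (sub_nonneg.2 hx)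
  rwa [map_sub, expEnd_lind_algebraMap, sub_nonneg] at this

theorem norm_expEnd_lind_sub_le (hb : ∀ j, (b j).IsHermitian) {t : ℝ} (ht : 0 ≤ t)
    {x : Matrix m m ℂ} (hx : IsSelfAdjoint x) :
    ‖expEnd (lind b) t x - x‖ ≤ ‖lind b x‖ * t := by
  have hL : IsSelfAdjoint (lind b x) := by rw [isSelfAdjoint_iff, ← lind_star hb, hx.star_eq]
  have h := norm_image_sub_le_of_norm_deriv_le_segment' (f := fun s => expEnd (lind b) s x)
    (f' := fun s => expEnd (lind b) s (lind b x)) (a := 0) (b := t) (C := ‖lind b x‖)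
    (fun s _ => (hasDerivAt_expEnd (lind b) s x).hasDerivWithinAt)
    (fun s hs => norm_expEnd_lind_le hb hs.1 hL) t ⟨ht, le_rfl⟩
  simpa [expEnd_zero] using h

end Lindblad

/-! ### Entropy along the semigroup -/

section Transport

variable {m : Type*} [Fintype m] {ι : Type*} [Fintype ι] {b : ι → Matrix m m ℂ}

theorem trace_mul_self_nonneg {x : Matrix m m ℂ} (hx : IsSelfAdjoint x) :
    0 ≤ (x * x).trace.re := by
  have h := Matrix.posSemidef_conjTranspose_mul_self x
  rw [← Matrix.star_eq_conjTranspose, hx.star_eq] at h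
  exact (Complex.le_def.1 h.trace_nonneg).1

variable [DecidableEq m]

/-- The negative entropy `tr (ρ log ρ)`. -/
noncomputable def negEntropy (ρ : Matrix m m ℂ) : ℝ := (ρ * cfc Real.log ρ).trace.re

/-- The real number `tr (ρ (log ρ - log σ))`, which is the relative entropy when `σ` is
invertible. -/
noncomputable def relEnt (ρ σ : Matrix m m ℂ) : ℝ :=
  (ρ * (cfc Real.log ρ - cfc Real.log σ)).trace.re

theorem trace_mul_sq_le {x y : Matrix m m ℂ} (hx : IsSelfAdjoint x) (hy : IsSelfAdjoint y) :
    (x * y).trace.re ^ 2 ≤ (x * x).trace.re * (y * y).trace.re := by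
  have h : ∀ s : ℝ, 0 ≤ (y * y).trace.re * (s * s) + 2 * (x * y).trace.re * s
      + (x * x).trace.re := fun s => by
    have h1 := trace_mul_self_nonneg (hx.add ((IsSelfAdjoint.all s).smul hy))
    have h2 : ((x + s • y) * (x + s • y)).trace.re = (y * y).trace.re * (s * s) +
        2 * (x * y).trace.re * s + (x * x).trace.re := by
      simp only [add_mul, mul_add, Matrix.trace_add, smul_mul_assoc, mul_smul_comm,
        Matrix.trace_smul, Complex.add_re, Complex.smul_re, smul_eq_mul, Matrix.trace_mul_comm y x]
      ring
    rwa [h2] at h1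
  have h3 := discrim_le_zero h
  rw [discrim] at h3
  nlinarith

theorem relEnt_nonneg {ρ σ : Matrix m m ℂ} (hρ : ρ.PosDef) (hσ : σ.PosDef)
    (hρ1 : ρ.trace = 1) (hσ1 : σ.trace = 1) : 0 ≤ relEnt ρ σ :=
  le_trans (div_nonneg (trace_mul_self_nonneg (hρ.1.isSelfAdjoint.sub hσ.1.isSelfAdjoint))
    (by norm_num)) (sq_dist_le_relEntropy hρ hσ hρ1 hσ1)

theorem exists_pos_algebraMap_le {ρ : Matrix m m ℂ} (hρ : ρ.PosDef) :
    ∃ c : ℝ, 0 < c ∧ algebraMap ℝ _ c ≤ ρ := by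
  cases isEmpty_or_nonempty m
  · exact ⟨1, one_pos, (Subsingleton.elim _ _).le⟩
  have h : ∀ x ∈ spectrum ℝ ρ, 0 < x := fun x hx => by
    rw [hρ.1.spectrum_real_eq_range_eigenvalues] at hx
    obtain ⟨i, rfl⟩ := hx
    exact hρ.eigenvalues_pos i
  have := (CFC.exists_pos_algebraMap_le_iff (a := ρ) hρ.1.isSelfAdjoint).2 h
  obtain ⟨c, hc, h⟩ := this
  exact ⟨c, hc, h⟩

theorem posDef_of_algebraMap_le {ρ : Matrix m m ℂ} {c : ℝ} (hc : 0 < c)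
    (h : algebraMap ℝ _ c ≤ ρ) : ρ.PosDef := by
  have h1 : ((algebraMap ℝ (Matrix m m ℂ)) c).PosDef := by
    rw [Algebra.algebraMap_eq_smul_one]
    exact Matrix.PosDef.one.smul hc
  have h2 := h1.add_posSemidef (Matrix.le_iff.1 h)
  rwa [add_sub_cancel] at h2

theorem posDef_expEnd_lind (hb : ∀ j, (b j).IsHermitian) {t : ℝ} (ht : 0 ≤ t)
    {ρ : Matrix m m ℂ} (hρ : ρ.PosDef) : (expEnd (lind b) t ρ).PosDef := by
  obtain ⟨c, hc, h⟩ := exists_pos_algebraMap_le hρ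
  exact posDef_of_algebraMap_le hc (algebraMap_le_expEnd_lind hb ht h)

theorem norm_cfc_log_le {ρ : Matrix m m ℂ} (hρ : ρ.PosDef) (h1 : ρ.trace = 1) {c : ℝ} (hc : 0 < c)
    (h : algebraMap ℝ _ c ≤ ρ) : ‖cfc Real.log ρ‖ ≤ |Real.log c| := by
  refine norm_cfc_le (abs_nonneg _) fun x hx => ?_
  have hcx : c ≤ x := (algebraMap_le_iff_le_spectrum hρ.1.isSelfAdjoint).1 h x hx
  have hx1 : x ≤ 1 := by
    rw [hρ.1.spectrum_real_eq_range_eigenvalues] at hx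
    obtain ⟨i, rfl⟩ := hx
    exact eigenvalues_le_one_of_trace_eq_one hρ.posSemidef h1 i
  have hx0 : 0 < x := hc.trans_le hcx
  rw [Real.norm_eq_abs, abs_of_nonpos (Real.log_nonpos hx0.le hx1),
    abs_of_nonpos (Real.log_nonpos hc.le (hcx.trans hx1)), neg_le_neg_iff]
  exact Real.log_le_log hc hcx

/-- Integration by parts for `L = -½ ∑ [b_j, [b_j, ·]]`. -/
theorem trace_mul_lind (b : ι → Matrix m m ℂ) (x y : Matrix m m ℂ) :
    (x * lind b y).trace = (1 / 2 : ℂ) *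
      ∑ j, ((b j * x - x * b j) * (b j * y - y * b j)).trace := by
  rw [lind_apply, Finset.mul_sum, Finset.mul_sum, Matrix.trace_sum]
  refine Finset.sum_congr rfl fun j _ => ?_
  simp only [sub_mul, mul_sub, mul_smul_comm, mul_add, Matrix.trace_sub, Matrix.trace_smul,
    Matrix.trace_add, smul_eq_mul]
  have h1 : (b j * x * (b j * y)).trace = (x * (b j * y * b j)).trace := by
    rw [mul_assoc, Matrix.trace_mul_comm]; simp only [mul_assoc]
  have h2 : (b j * x * (y * b j)).trace = (x * (y * b j ^ 2)).trace := by
    rw [mul_assoc, Matrix.trace_mul_comm, sq]; simp only [mul_assoc]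
  have h3 : (x * b j * (b j * y)).trace = (x * (b j ^ 2 * y)).trace := by
    rw [sq]; simp only [mul_assoc]
  have h4 : (x * b j * (y * b j)).trace = (x * (b j * y * b j)).trace := by simp only [mul_assoc]
  rw [h1, h2, h3, h4]
  ring

theorem trace_lind_mul_log (b : ι → Matrix m m ℂ) (ρ : Matrix m m ℂ) :
    (lind b ρ * cfc Real.log ρ).trace.re = -(1 / 2) * ∑ j,
      (2 * (b j * b j * (ρ * cfc Real.log ρ)).trace.re -
        2 * (b j * ρ * b j * cfc Real.log ρ).trace.re) := by
  have hc : ρ * cfc Real.log ρ = cfc Real.log ρ * ρ := by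
    have := (Commute.refl ρ).cfc_real Real.log
    exact this.eq.symm
  set l := cfc Real.log ρ
  rw [lind_apply, Finset.sum_mul, Matrix.trace_sum, Complex.re_sum, Finset.mul_sum]
  refine Finset.sum_congr rfl fun j _ => ?_
  have h1 : (b j ^ 2 * ρ * l).trace = (b j * b j * (ρ * l)).trace := by
    rw [sq]; simp only [mul_assoc]
  have h2 : (ρ * b j ^ 2 * l).trace = (b j * b j * (ρ * l)).trace := by
    rw [mul_assoc, Matrix.trace_mul_comm, hc, sq]; simp only [mul_assoc]
  simp only [sub_mul, smul_mul_assoc, add_mul, Matrix.trace_sub, Matrix.trace_smul,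
    Matrix.trace_add, h1, h2, smul_eq_mul]
  rw [← two_mul, ← mul_assoc]
  norm_num
  ring

/-- The rate of change of `tr (X ρ)` is controlled by the entropy production
`-tr (L(ρ) log ρ)`, for `X` with commutators `[b_j, X]` of norm at most one. -/
theorem abs_trace_mul_lind_le (hb : ∀ j, (b j).IsHermitian) {ρ X : Matrix m m ℂ} (hρ : ρ.PosDef)
    (hρ1 : ρ.trace = 1) (hX : ∀ j, ‖b j * X - X * b j‖ ≤ 1) {κ : ℝ} (hκ : 0 < κ) :
    |(X * lind b ρ).trace.re| ≤ Fintype.card ι * κ / 2 -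
      1 / (4 * κ) * (lind b ρ * cfc Real.log ρ).trace.re := by
  have h1 : (X * lind b ρ).trace.re =
      1 / 2 * ∑ j, ((b j * X - X * b j) * (b j * ρ - ρ * b j)).trace.re := by
    rw [trace_mul_lind, ← Complex.re_sum]
    norm_num
  rw [h1, trace_lind_mul_log, abs_mul, abs_of_pos (by norm_num : (0 : ℝ) < 1 / 2)]
  have h2 : |∑ j, ((b j * X - X * b j) * (b j * ρ - ρ * b j)).trace.re| ≤
      ∑ j, (κ * 1 + 1 / (4 * κ) * (2 * (b j * b j * (ρ * cfc Real.log ρ)).trace.re -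
        2 * (b j * ρ * b j * cfc Real.log ρ).trace.re)) := by
    refine (Finset.abs_sum_le_sum_abs _ _).trans (Finset.sum_le_sum fun j _ => ?_)
    have := abs_trace_mul_commutator_le hρ (hb j) (hX j) hκ
    rwa [hρ1, Complex.one_re] at this
  rw [Finset.sum_add_distrib, Finset.sum_const, Finset.card_univ, nsmul_eq_mul,
    ← Finset.mul_sum] at h2
  linarith

/-- The change of `tr (X ρ)` along the semigroup is controlled by the loss of entropy. The
derivative of the entropy is not computed: Klein's inequality gives the one-sided estimate that the
comparison on short intervals requires. -/
theorem trace_sub_expEnd_le (hb : ∀ j, (b j).IsHermitian) {ρ X : Matrix m m ℂ} (hρ : ρ.PosDef)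
    (hρ1 : ρ.trace = 1) (hX : ∀ j, ‖b j * X - X * b j‖ ≤ 1) {κ : ℝ} (hκ : 0 < κ) {t : ℝ}
    (ht : 0 ≤ t) :
    (X * (ρ - expEnd (lind b) t ρ)).trace.re ≤ Fintype.card ι * κ / 2 * t +
      1 / (4 * κ) * (negEntropy ρ - negEntropy (expEnd (lind b) t ρ)) := by
  obtain ⟨c, hc, hcρ⟩ := exists_pos_algebraMap_le hρ
  obtain ⟨C, hC, H⟩ := exists_norm_expEnd_sub_le (lind b) t
  -- Up to second-order errors, `G` is increasing by `abs_trace_mul_lind_le`.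
  set G : ℝ → ℝ := fun s => (X * expEnd (lind b) s ρ).trace.re + Fintype.card ι * κ / 2 * s -
    1 / (4 * κ) * negEntropy (expEnd (lind b) s ρ) with hG
  have hmono := le_of_quadratic_error (G := G) (C := Fintype.card m *
    ((‖X‖ + 1 / (4 * κ) * |Real.log c|) * (C * ‖ρ‖))) ht ?_
  · simp only [hG, expEnd_zero] at hmono
    rw [mul_sub, Matrix.trace_sub, Complex.sub_re]
    linarith
  intro s h hs hh hsh
  have hsh0 : 0 ≤ s + h := add_nonneg hs hh
  set ρ₁ := expEnd (lind b) s ρ with hρ₁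
  set ρ₂ := expEnd (lind b) (s + h) ρ with hρ₂
  have hp₁ : ρ₁.PosDef := posDef_expEnd_lind hb hs hρ
  have hp₂ : ρ₂.PosDef := posDef_expEnd_lind hb hsh0 hρ
  have ht₁ : ρ₁.trace = 1 := by rw [hρ₁, trace_expEnd_lind, hρ1]
  have ht₂ : ρ₂.trace = 1 := by rw [hρ₂, trace_expEnd_lind, hρ1]
  -- The expansion is centred at the end point `ρ₂` and goes backwards in time, since Klein's
  -- inequality bounds the entropy loss from below in terms of `log ρ₂`.
  have hback : expEnd (lind b) (-h) ρ₂ = ρ₁ := by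
    rw [hρ₂, ← expEnd_add, neg_add_cancel_comm_assoc]
  have hn₂ : ‖ρ₂‖ ≤ ‖ρ‖ := norm_expEnd_lind_le hb hsh0 hρ.1.isSelfAdjoint
  have hlog : ‖cfc Real.log ρ₂‖ ≤ |Real.log c| :=
    norm_cfc_log_le hp₂ ht₂ hc (algebraMap_le_expEnd_lind hb hsh0 hcρ)
  set l := cfc Real.log ρ₂ with hl
  set R := ρ₁ - ρ₂ + (h : ℂ) • lind b ρ₂ with hR
  have hRn : ‖R‖ ≤ C * h ^ 2 * ‖ρ‖ := by
    have := H (-h) (by rw [abs_neg, abs_of_nonneg hh]; linarith) ρ₂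
    rw [hback, neg_sq, Complex.ofReal_neg, neg_smul, sub_neg_eq_add] at this
    exact this.trans (by gcongr)
  have hρR : ρ₁ - ρ₂ = R - (h : ℂ) • lind b ρ₂ := by rw [hR]; abel
  have hklein : ((ρ₁ - ρ₂) * l).trace.re ≤ negEntropy ρ₁ - negEntropy ρ₂ := by
    have := relEnt_nonneg hp₁ hp₂ ht₁ ht₂
    rw [relEnt, mul_sub, Matrix.trace_sub, Complex.sub_re] at this
    rw [negEntropy, negEntropy, sub_mul, Matrix.trace_sub, Complex.sub_re]
    linarith
  have e1 : ((ρ₁ - ρ₂) * l).trace.re = (R * l).trace.re - h * (lind b ρ₂ * l).trace.re := by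
    rw [hρR, sub_mul, smul_mul_assoc, Matrix.trace_sub, Matrix.trace_smul, Complex.sub_re,
      smul_eq_mul, Complex.re_ofReal_mul]
  have e2 : (X * ρ₁).trace.re - (X * ρ₂).trace.re =
      (X * R).trace.re - h * (X * lind b ρ₂).trace.re := by
    rw [← Complex.sub_re, ← Matrix.trace_sub, ← mul_sub, hρR, mul_sub, mul_smul_comm,
      Matrix.trace_sub, Matrix.trace_smul, Complex.sub_re, smul_eq_mul, Complex.re_ofReal_mul]
  have hrate := mul_le_mul_of_nonneg_left
    (neg_le_of_abs_le (abs_trace_mul_lind_le hb hp₂ ht₂ hX hκ)) hh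
  have b1 : (X * R).trace.re ≤ Fintype.card m * (‖X‖ * ‖R‖) :=
    (Complex.re_le_norm _).trans ((norm_trace_le _).trans (by gcongr; exact norm_mul_le _ _))
  have b2 : -(R * l).trace.re ≤ Fintype.card m * (|Real.log c| * ‖R‖) := by
    refine (neg_le_abs _).trans ((Complex.abs_re_le_norm _).trans ((norm_trace_le _).trans ?_))
    gcongr
    exact (norm_mul_le _ _).trans (by rw [mul_comm]; gcongr)
  have hκ' : 0 < 1 / (4 * κ) := by positivity
  have b3 := mul_le_mul_of_nonneg_left hklein hκ'.le
  have b4 := mul_le_mul_of_nonneg_left b2 hκ'.le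
  have b5 : Fintype.card m * ((‖X‖ + 1 / (4 * κ) * |Real.log c|) * ‖R‖) ≤
      Fintype.card m * ((‖X‖ + 1 / (4 * κ) * |Real.log c|) * (C * h ^ 2 * ‖ρ‖)) := by gcongr
  simp only [hG]
  rw [e1] at b3
  nlinarith

/-- Relative to an invariant state `σ`, relative entropy and negative entropy change by the same
amount, because `log σ` is invariant as well. -/
theorem relEnt_sub_relEnt_expEnd {ρ σ : Matrix m m ℂ} (hσb : ∀ j, Commute (b j) σ) (t : ℝ) :
    relEnt ρ σ - relEnt (expEnd (lind b) t ρ) σ =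
      negEntropy ρ - negEntropy (expEnd (lind b) t ρ) := by
  have h : (expEnd (lind b) t ρ * cfc Real.log σ).trace = (ρ * cfc Real.log σ).trace := by
    rw [trace_expEnd_lind_mul, expEnd_lind_of_commute]
    exact fun j => ((hσb j).symm.cfc_real Real.log).symm
  simp only [relEnt, negEntropy, mul_sub, Matrix.trace_sub, Complex.sub_re, h]
  ring

theorem sq_le_of_forall_le_mul_add_div {x p q : ℝ} (hx : 0 ≤ x) (hp : 0 ≤ p) (hq : 0 ≤ q)
    (h : ∀ κ : ℝ, 0 < κ → x ≤ p * κ + q / κ) : x ^ 2 ≤ 4 * p * q := by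
  have h1 : ∀ κ : ℝ, 0 ≤ p * (κ * κ) + (-x) * κ + q := fun κ => by
    rcases le_or_gt κ 0 with hκ | hκ
    · have : 0 ≤ x * (-κ) := mul_nonneg hx (by linarith)
      have := mul_nonneg hp (mul_self_nonneg κ)
      nlinarith
    · have := mul_le_mul_of_nonneg_right (h κ hκ) hκ.le
      rw [add_mul, div_mul_cancel₀ _ hκ.ne'] at this
      linarith
  have h2 := discrim_le_zero h1
  rw [discrim] at h2
  linarith

theorem sq_trace_sub_expEnd_le (hb : ∀ j, (b j).IsHermitian) {ρ σ X : Matrix m m ℂ}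
    (hρ : ρ.PosDef) (hσ : σ.PosDef) (hρ1 : ρ.trace = 1) (hσ1 : σ.trace = 1)
    (hσb : ∀ j, Commute (b j) σ) (hX : ∀ j, ‖b j * X - X * b j‖ ≤ 1) {t : ℝ} (ht : 0 ≤ t) :
    (X * (ρ - expEnd (lind b) t ρ)).trace.re ^ 2 ≤
      Fintype.card ι * t / 2 * relEnt ρ σ := by
  have hD := relEnt_nonneg hρ hσ hρ1 hσ1
  have hDt := relEnt_nonneg (posDef_expEnd_lind hb ht hρ) hσ
    (by rw [trace_expEnd_lind, hρ1]) hσ1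
  have hdiff := relEnt_sub_relEnt_expEnd (ρ := ρ) hσb t
  have key : ∀ Z : Matrix m m ℂ, (∀ j, ‖b j * Z - Z * b j‖ ≤ 1) → ∀ κ : ℝ, 0 < κ →
      (Z * (ρ - expEnd (lind b) t ρ)).trace.re ≤
        Fintype.card ι * t / 2 * κ + relEnt ρ σ / 4 / κ := fun Z hZ κ hκ => by
    have h := trace_sub_expEnd_le hb hρ hρ1 hZ hκ ht
    rw [← hdiff] at h
    have h2 : 1 / (4 * κ) * (relEnt ρ σ - relEnt (expEnd (lind b) t ρ) σ) ≤
        1 / (4 * κ) * relEnt ρ σ := by gcongr; linarith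
    have h3 : 1 / (4 * κ) * relEnt ρ σ = relEnt ρ σ / 4 / κ := by field_simp
    linarith
  have hX' : ∀ j, ‖b j * (-X) - (-X) * b j‖ ≤ 1 := fun j => by
    have : b j * (-X) - (-X) * b j = -(b j * X - X * b j) := by
      rw [mul_neg, neg_mul]; abel
    rw [this, norm_neg]; exact hX j
  have habs := sq_le_of_forall_le_mul_add_div
    (abs_nonneg (X * (ρ - expEnd (lind b) t ρ)).trace.re)
    (p := Fintype.card ι * t / 2) (q := relEnt ρ σ / 4) (by positivity) (by positivity)
    fun κ hκ => abs_le'.2 ⟨key X hX κ hκ, by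
      have := key (-X) hX' κ hκ
      rwa [neg_mul, Matrix.trace_neg, Complex.neg_re] at this⟩
  rw [sq_abs] at habs
  linarith

/-- Transport inequality: if the relative entropy of `ρ` with respect to an invariant state `σ`
decays exponentially at rate `r`, then `tr (X ρ)` is controlled by the relative entropy for
Lipschitz `X` with `tr (X σ) = 0`. The time axis is cut into intervals of length `2 / r`; over each
of them the relative entropy drops by a factor of at least four, so the bounds on the increments of
`tr (X ρ)` form a geometric series with ratio one half. -/
theorem sq_trace_mul_le_of_decay (hb : ∀ j, (b j).IsHermitian) {ρ σ X : Matrix m m ℂ}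
    (hρ : ρ.PosDef) (hσ : σ.PosDef) (hρ1 : ρ.trace = 1) (hσ1 : σ.trace = 1)
    (hσb : ∀ j, Commute (b j) σ) (hXs : IsSelfAdjoint X) (hX : ∀ j, ‖b j * X - X * b j‖ ≤ 1)
    (hXσ : (X * σ).trace = 0) {r : ℝ} (hr : 0 < r)
    (hdecay : ∀ s, 0 ≤ s → relEnt (expEnd (lind b) s ρ) σ ≤ Real.exp (-(r * s)) * relEnt ρ σ) :
    (X * ρ).trace.re ^ 2 ≤ 4 * Fintype.card ι * relEnt ρ σ / r := by
  set D := relEnt ρ σ with hDdef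
  have hD : 0 ≤ D := relEnt_nonneg hρ hσ hρ1 hσ1
  set τ : ℕ → ℝ := fun k => k * (2 / r) with hτ
  have hτ0 : ∀ k, 0 ≤ τ k := fun k => by positivity
  set ρk : ℕ → Matrix m m ℂ := fun k => expEnd (lind b) (τ k) ρ with hρk
  have hpos : ∀ k, (ρk k).PosDef := fun k => posDef_expEnd_lind hb (hτ0 k) hρ
  have htr : ∀ k, (ρk k).trace = 1 := fun k => by rw [hρk, trace_expEnd_lind, hρ1]
  have hDk : ∀ k, relEnt (ρk k) σ ≤ ((1 / 2) ^ k) ^ 2 * D := fun k => by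
    refine (hdecay _ (hτ0 k)).trans (mul_le_mul_of_nonneg_right ?_ hD)
    have h1 : Real.exp (-(r * τ k)) = (Real.exp (-1) ^ k) ^ 2 := by
      rw [← pow_mul, ← Real.exp_nat_mul]
      congr 1
      simp only [hτ]
      push_cast
      field_simp
    rw [h1]
    have h2 : Real.exp (-1) ≤ 1 / 2 := by
      rw [Real.exp_neg, inv_le_comm₀ (Real.exp_pos 1) (by norm_num)]
      have := Real.add_one_le_exp (1 : ℝ)
      norm_num at this ⊢
      linarith
    gcongr
  set A := √(Fintype.card ι * D / r) with hA
  have hA2 : A ^ 2 = Fintype.card ι * D / r := Real.sq_sqrt (by positivity)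
  have hA0 : 0 ≤ A := Real.sqrt_nonneg _
  have hstep : ∀ k, |(X * (ρk k - ρk (k + 1))).trace.re| ≤ A * (1 / 2) ^ k := fun k => by
    have h1 : ρk (k + 1) = expEnd (lind b) (2 / r) (ρk k) := by
      simp only [hρk, hτ]
      rw [← expEnd_add]
      congr 2
      push_cast
      ring
    rw [h1]
    refine abs_le_of_sq_le_sq ?_ (by positivity)
    refine (sq_trace_sub_expEnd_le hb (hpos k) hσ (htr k) hσ1 hσb hX (by positivity)).trans ?_
    rw [mul_pow, hA2]
    calc (Fintype.card ι : ℝ) * (2 / r) / 2 * relEnt (ρk k) σ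
        ≤ Fintype.card ι * (2 / r) / 2 * (((1 / 2) ^ k) ^ 2 * D) := by gcongr; exact hDk k
      _ = _ := by field_simp
  have hsum : ∀ k, |(X * (ρ - ρk k)).trace.re| ≤ 2 * A * (1 - (1 / 2) ^ k) := fun k => by
    induction k with
    | zero => simp [hρk, hτ, expEnd_zero]
    | succ k ih =>
      have h1 : (X * (ρ - ρk (k + 1))).trace.re =
          (X * (ρ - ρk k)).trace.re + (X * (ρk k - ρk (k + 1))).trace.re := by
        rw [← Complex.add_re, ← Matrix.trace_add, ← mul_add]
        congr 3
        abel
      rw [h1]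
      refine (abs_add_le _ _).trans ((add_le_add ih (hstep k)).trans (le_of_eq ?_))
      rw [pow_succ]
      ring
  set B := √(4 * (X * X).trace.re * D) with hB
  have hXX := trace_mul_self_nonneg hXs
  have hB2 : B ^ 2 = 4 * (X * X).trace.re * D := Real.sq_sqrt (by positivity)
  -- Klein's inequality makes `ρ_k` converge to `σ` in the Hilbert–Schmidt norm.
  have hend : ∀ k, |(X * ρk k).trace.re| ≤ B * (1 / 2) ^ k := fun k => by
    have h1 : (X * ρk k).trace.re = (X * (ρk k - σ)).trace.re := by
      rw [mul_sub, Matrix.trace_sub, hXσ, sub_zero]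
    rw [h1]
    refine abs_le_of_sq_le_sq ?_ (by positivity)
    refine (trace_mul_sq_le hXs ((hpos k).1.isSelfAdjoint.sub hσ.1.isSelfAdjoint)).trans ?_
    have h2 := (sq_dist_le_relEntropy (hpos k) hσ (htr k) hσ1).trans (hDk k)
    rw [mul_pow, hB2]
    calc (X * X).trace.re * ((ρk k - σ) * (ρk k - σ)).trace.re
        ≤ (X * X).trace.re * (4 * (((1 / 2) ^ k) ^ 2 * D)) := by gcongr; linarith
      _ = _ := by ring
  have hk : ∀ k, |(X * ρ).trace.re| ≤ 2 * A + B * (1 / 2) ^ k := fun k => by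
    have h1 : (X * ρ).trace.re = (X * (ρ - ρk k)).trace.re + (X * ρk k).trace.re := by
      rw [← Complex.add_re, ← Matrix.trace_add, ← mul_add, sub_add_cancel]
    rw [h1]
    refine (abs_add_le _ _).trans ((add_le_add (hsum k) (hend k)).trans ?_)
    have : 0 ≤ A * (1 / 2) ^ k := by positivity
    linarith
  have hlim : |(X * ρ).trace.re| ≤ 2 * A := by
    refine ge_of_tendsto' (x := Filter.atTop) ?_ hk
    have := (tendsto_pow_atTop_nhds_zero_of_lt_one (r := (1 / 2 : ℝ)) (by norm_num)
      (by norm_num)).const_mul B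
    simpa using this.const_add (2 * A)
  calc (X * ρ).trace.re ^ 2 = |(X * ρ).trace.re| ^ 2 := (sq_abs _).symm
    _ ≤ (2 * A) ^ 2 := by gcongr
    _ = _ := by rw [mul_pow, hA2]; ring

end Transport

/-! ### Positivity and conditional expectations -/

section CondExp

variable {m : Type*} [Fintype m] {ι : Type*} {b : ι → Matrix m m ℂ}

theorem commute_star (hb : ∀ j, (b j).IsHermitian) {x : Matrix m m ℂ}
    (h : ∀ j, Commute (b j) x) (j : ι) : Commute (b j) (star x) := by
  have h1 := (h j).star_star
  rwa [(hb j).isSelfAdjoint.star_eq] at h1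

theorem eq_zero_of_forall_trace_mul (hb : ∀ j, (b j).IsHermitian) {z : Matrix m m ℂ}
    (hz : ∀ j, Commute (b j) z) (h : ∀ y, (∀ j, Commute (b j) y) → (z * y).trace = 0) :
    z = 0 := by
  rw [← Matrix.trace_conjTranspose_mul_self_eq_zero_iff, Matrix.trace_mul_comm]
  exact h _ (commute_star hb hz)

/-- `E` is the trace-preserving conditional expectation onto the commutant of the `b_j`. For
Hermitian `b_j` the two properties determine `E`. -/
structure IsCondExp (b : ι → Matrix m m ℂ) (E : Matrix m m ℂ → Matrix m m ℂ) : Prop where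
  commute : ∀ x j, Commute (b j) (E x)
  trace_mul : ∀ x y, (∀ j, Commute (b j) y) → (E x * y).trace = (x * y).trace

variable {E : Matrix m m ℂ → Matrix m m ℂ}

theorem IsCondExp.star_apply (hE : IsCondExp b E) (hb : ∀ j, (b j).IsHermitian)
    (x : Matrix m m ℂ) : E (star x) = star (E x) := by
  rw [← sub_eq_zero]
  refine eq_zero_of_forall_trace_mul hb
    (fun j => (hE.commute _ j).sub_right (commute_star hb (hE.commute x) j)) fun y hy => ?_
  have h1 : ∀ z : Matrix m m ℂ, (star z * y).trace = star ((z * star y).trace) := fun z => by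
    rw [← Matrix.trace_conjTranspose, ← Matrix.star_eq_conjTranspose, star_mul, star_star,
      Matrix.trace_mul_comm]
  rw [sub_mul, Matrix.trace_sub, hE.trace_mul _ _ hy, h1, h1, hE.trace_mul _ _ (commute_star hb hy),
    sub_self]

variable [DecidableEq m]

theorem nonneg_of_trace_mul_negPart_nonneg {z : Matrix m m ℂ} (hz : IsSelfAdjoint z)
    (h : 0 ≤ (z * z⁻).trace.re) : 0 ≤ z := by
  have hn : IsSelfAdjoint z⁻ := IsSelfAdjoint.of_nonneg (CFC.negPart_nonneg z)
  have h1 : z * z⁻ = -(z⁻ * z⁻) := by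
    nth_rewrite 1 [← CFC.posPart_sub_negPart z hz]
    rw [sub_mul, CFC.posPart_mul_negPart, zero_sub]
  rw [h1, Matrix.trace_neg, Complex.neg_re] at h
  have h2 : (z⁻ * z⁻).trace = 0 := by
    have h3 := Matrix.posSemidef_conjTranspose_mul_self z⁻
    rw [← Matrix.star_eq_conjTranspose, hn.star_eq] at h3
    have h4 := Complex.le_def.1 h3.trace_nonneg
    exact Complex.ext (le_antisymm (by simpa using h) h4.1) h4.2.symm
  have h5 : z⁻ = 0 := by
    rw [← Matrix.trace_conjTranspose_mul_self_eq_zero_iff, ← Matrix.star_eq_conjTranspose,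
      hn.star_eq, h2]
  rw [← CFC.posPart_sub_negPart z hz, h5, sub_zero]
  exact CFC.posPart_nonneg z

/-- A self-adjoint matrix is nonnegative if it pairs nonnegatively with all invertible positive
matrices: test it on `z⁻ + ε`. -/
theorem nonneg_of_forall_posDef {z : Matrix m m ℂ} (hz : IsSelfAdjoint z)
    (h : ∀ ρ : Matrix m m ℂ, ρ.PosDef → 0 ≤ (z * ρ).trace.re) : 0 ≤ z := by
  refine nonneg_of_trace_mul_negPart_nonneg hz (le_of_forall_pos_le_add fun ε hε => ?_)
  have hδ : 0 < ε / (|z.trace.re| + 1) := by positivity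
  have h1 := h (z⁻ + algebraMap ℝ _ (ε / (|z.trace.re| + 1)))
    (posDef_of_algebraMap_le hδ (le_add_of_nonneg_left (CFC.negPart_nonneg z)))
  rw [mul_add, Matrix.trace_add, Complex.add_re, Algebra.algebraMap_eq_smul_one, mul_smul_comm,
    mul_one, Matrix.trace_smul, Complex.smul_re, smul_eq_mul] at h1
  have h2 : ε / (|z.trace.re| + 1) * z.trace.re ≤ ε := by
    rw [div_mul_eq_mul_div, div_le_iff₀ (by positivity)]
    nlinarith [le_abs_self z.trace.re]
  linarith

theorem IsCondExp.algebraMap_le (hE : IsCondExp b E) (hb : ∀ j, (b j).IsHermitian)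
    {ρ : Matrix m m ℂ} (hρ : IsSelfAdjoint ρ) {c : ℝ} (h : algebraMap ℝ _ c ≤ ρ) :
    algebraMap ℝ _ c ≤ E ρ := by
  have hσ : IsSelfAdjoint (E ρ) := by
    rw [isSelfAdjoint_iff, ← hE.star_apply hb, hρ.star_eq]
  rw [← sub_nonneg]
  set z := E ρ - algebraMap ℝ _ c with hz
  have hzs : IsSelfAdjoint z := hσ.sub (IsSelfAdjoint.algebraMap _ (.all _))
  have hzc : ∀ j, Commute (b j) z := fun j =>
    (hE.commute ρ j).sub_right (Algebra.commutes c (b j)).symm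
  refine nonneg_of_trace_mul_negPart_nonneg hzs ?_
  have hnc : ∀ j, Commute (b j) z⁻ := fun j => by
    rw [CFC.negPart_def]
    exact ((hzc j).symm.cfcₙ_real _).symm
  have h1 : (z * z⁻).trace = ((ρ - algebraMap ℝ _ c) * z⁻).trace := by
    rw [hz, sub_mul, sub_mul, Matrix.trace_sub, Matrix.trace_sub, hE.trace_mul _ _ hnc]
  rw [h1]
  exact trace_mul_nonneg (Matrix.le_iff.1 h)
    (Matrix.nonneg_iff_posSemidef.1 (CFC.negPart_nonneg z))

theorem IsCondExp.posDef (hE : IsCondExp b E) (hb : ∀ j, (b j).IsHermitian)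
    {ρ : Matrix m m ℂ} (hρ : ρ.PosDef) : (E ρ).PosDef := by
  obtain ⟨c, hc, h⟩ := exists_pos_algebraMap_le hρ
  exact posDef_of_algebraMap_le hc (hE.algebraMap_le hb hρ.1.isSelfAdjoint h)

theorem IsCondExp.trace_apply (hE : IsCondExp b E) (x : Matrix m m ℂ) :
    (E x).trace = x.trace := by
  simpa using hE.trace_mul x 1 fun j => Commute.one_right _

/-- The relative entropy is at most the logarithm of the comparison constant, because the logarithm
is operator monotone. -/
theorem relEnt_le_log {ρ σ : Matrix m m ℂ} (hρ : ρ.PosDef) (hσ : σ.PosDef) (hρ1 : ρ.trace = 1)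
    {α : ℝ} (hα : 0 < α) (h : ρ ≤ α • σ) : relEnt ρ σ ≤ Real.log α := by
  have h1 : cfc Real.log ρ ≤ cfc Real.log (α • σ) :=
    CFC.log_le_log h hρ.isStrictlyPositive
  have h2 : cfc Real.log (α • σ) = algebraMap ℝ _ (Real.log α) + cfc Real.log σ :=
    CFC.log_smul σ (fun x hx => (hσ.isStrictlyPositive.spectrum_pos hx).ne') hα.ne'
      hσ.1.isSelfAdjoint
  rw [h2] at h1
  have h3 := trace_mul_nonneg hρ.posSemidef (Matrix.le_iff.1 h1)
  have h4 : ρ * (algebraMap ℝ _ (Real.log α) + cfc Real.log σ - cfc Real.log ρ) =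
      Real.log α • ρ - ρ * (cfc Real.log ρ - cfc Real.log σ) := by
    rw [Algebra.algebraMap_eq_smul_one]
    simp only [mul_sub, mul_add, mul_smul_comm, mul_one]
    abel
  rw [h4, Matrix.trace_sub, Matrix.trace_smul, hρ1, Complex.sub_re, Complex.smul_re,
    Complex.one_re, smul_eq_mul, mul_one] at h3
  exact sub_nonneg.1 h3

theorem relEntropy_eq_relEnt (ρ : Matrix m m ℂ) {σ : Matrix m m ℂ} (hσ : σ.PosDef) :
    relEntropy ρ σ = (relEnt ρ σ : EReal) := by
  refine if_pos fun v hv => ?_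
  have hu : Function.Injective σ.mulVec := Matrix.mulVec_injective_of_isUnit hσ.isUnit
  have : v = 0 := hu (by rw [hv, Matrix.mulVec_zero])
  rw [this, Matrix.mulVec_zero]

end CondExp

/-! ### Amplifications -/

section Amp

variable {n d : ℕ} {ι : Type*}

/-- The `(i, i')` block of a matrix in `M_n(M_d)`. -/
def block (i i' : Fin n) : MatAmp n d →ₗ[ℂ] Mat d where
  toFun X := Matrix.of fun k l => X (i, k) (i', l)
  map_add' _ _ := rfl
  map_smul' _ _ := rfl

theorem block_apply (i i' : Fin n) (X : MatAmp n d) (k l : Fin d) :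
    block i i' X k l = X (i, k) (i', l) := rfl

theorem ext_block {X Y : MatAmp n d} (h : ∀ i i', block i i' X = block i i' Y) : X = Y := by
  ext ⟨i, k⟩ ⟨i', l⟩
  exact congrFun (congrFun (h i i') k) l

theorem block_amp (Φ : Mat d →ₗ[ℂ] Mat d) (i i' : Fin n) (X : MatAmp n d) :
    block i i' (amp n Φ X) = Φ (block i i' X) := rfl

theorem block_kronecker_mul (a : Mat d) (i i' : Fin n) (X : MatAmp n d) :
    block i i' (((1 : Mat n) ⊗ₖ a) * X) = a * block i i' X := by
  ext k l
  simp [block_apply, Matrix.mul_apply, Fintype.sum_prod_type, Matrix.kroneckerMap_apply,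
    Matrix.one_apply]

theorem block_mul_kronecker (a : Mat d) (i i' : Fin n) (X : MatAmp n d) :
    block i i' (X * ((1 : Mat n) ⊗ₖ a)) = block i i' X * a := by
  ext k l
  simp [block_apply, Matrix.mul_apply, Fintype.sum_prod_type, Matrix.kroneckerMap_apply,
    Matrix.one_apply]

/-- The amplified jump operators `1 ⊗ a_j`. -/
abbrev ampJump (n : ℕ) {d : ℕ} (a : ι → Mat d) (j : ι) : MatAmp n d := (1 : Mat n) ⊗ₖ a j

theorem isHermitian_ampJump {a : ι → Mat d} (ha : ∀ j, (a j).IsHermitian) (j : ι) :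
    (ampJump n a j).IsHermitian := by
  rw [Matrix.IsHermitian, Matrix.conjTranspose_kronecker, (ha j).eq, Matrix.conjTranspose_one]

theorem commute_ampJump_iff (a : ι → Mat d) (j : ι) (X : MatAmp n d) :
    Commute (ampJump n a j) X ↔ ∀ i i', Commute (a j) (block i i' X) := by
  constructor
  · intro h i i'
    have := congrArg (block i i') h.eq
    rwa [block_kronecker_mul, block_mul_kronecker] at this
  · intro h
    refine ext_block fun i i' => ?_
    rw [block_kronecker_mul, block_mul_kronecker]
    exact h i i'

theorem amp_lindbladian [Fintype ι] (a : ι → Mat d) (X : MatAmp n d) :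
    amp n (lindbladian a) X = lind (ampJump n a) X := by
  refine ext_block fun i i' => ?_
  rw [block_amp, lind_apply, map_sum]
  refine Finset.sum_congr rfl fun j _ => ?_
  simp only [map_sub, map_smul, map_add, sq, mul_assoc, block_kronecker_mul]
  simp only [← mul_assoc, block_mul_kronecker]

theorem amp_expEnd (f : Mat d →ₗ[ℂ] Mat d) (t : ℝ) (X : MatAmp n d) :
    amp n (expEnd f t) X = expEnd (amp n f) t X := by
  refine ext_block fun i i' => ?_
  rw [block_amp]
  exact expEnd_intertwine (block i i') (fun _ => rfl) t X

theorem amp_semigroup [Fintype ι] (a : ι → Mat d) (t : ℝ) (X : MatAmp n d) :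
    amp n (semigroup (lindbladian a) t) X = expEnd (lind (ampJump n a)) t X := by
  have h : amp n (lindbladian a) = lind (ampJump n a) := LinearMap.ext (amp_lindbladian a)
  rw [← h]
  exact amp_expEnd _ t X

theorem traceDual_semigroup [Fintype ι] (a : ι → Mat d) (t : ℝ) :
    traceDual (semigroup (lindbladian a) t) = semigroup (lindbladian a) t := by
  refine LinearMap.ext fun x => ?_
  ext i j
  change (x * expEnd (lind a) t (Matrix.single j i 1)).trace = expEnd (lind a) t x i j
  rw [← trace_expEnd_lind_mul, Matrix.trace_mul_single]
  simp

theorem trace_mul_eq_sum_block (X Y : MatAmp n d) :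
    (X * Y).trace = ∑ i, ∑ i', (block i i' X * block i' i Y).trace := by
  simp only [Matrix.trace, Matrix.diag, Matrix.mul_apply, Fintype.sum_prod_type, block_apply]
  refine Finset.sum_congr rfl fun i _ => ?_
  rw [Finset.sum_comm]

theorem mem_commutant_range_iff (a : ι → Mat d) (x : Mat d) :
    x ∈ commutant (Set.range a) ↔ ∀ j, Commute (a j) x := by
  rw [commutant, Subalgebra.mem_centralizer_iff]
  simp only [Set.forall_mem_range]
  rfl

/-- The amplification of the conditional expectation onto the commutant of the `a_j` is the
conditional expectation onto the commutant of the `1 ⊗ a_j`. -/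
theorem isCondExp_amp {a : ι → Mat d} (ha : ∀ j, (a j).IsHermitian) :
    IsCondExp (ampJump n a) (amp n (condExp (commutant (Set.range a)))) where
  commute X j := by
    rw [commute_ampJump_iff]
    intro i i'
    rw [block_amp]
    exact (mem_commutant_range_iff a _).1 (condExp_mem _ _) j
  trace_mul X Y hY := by
    rw [trace_mul_eq_sum_block, trace_mul_eq_sum_block]
    refine Finset.sum_congr rfl fun i _ => Finset.sum_congr rfl fun i' _ => ?_
    rw [block_amp]
    refine trace_condExp_mul _ (fun y hy => ?_) _ _ ?_
    · rw [mem_commutant_range_iff] at hy ⊢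
      exact commute_star ha hy
    · rw [mem_commutant_range_iff]
      exact fun j => (commute_ampJump_iff a j Y).1 (hY j) i' i

/-- Homogeneity extends the bound by the completely bounded norm from the unit ball. -/
theorem enorm_amp_le (Φ : Mat d →ₗ[ℂ] Mat d) (hn : 1 ≤ n) (X : MatAmp n d) :
    ‖amp n Φ X‖ₑ ≤ cbNorm Φ * ‖X‖ₑ := by
  by_cases hX : X = 0
  · simp [hX]
  have hX0 : ‖X‖ ≠ 0 := norm_ne_zero_iff.2 hX
  set Y : MatAmp n d := ((‖X‖ : ℂ)⁻¹) • X with hY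
  have hXY : X = (‖X‖ : ℂ) • Y := by
    rw [hY, smul_smul, mul_inv_cancel₀ (by exact_mod_cast hX0), one_smul]
  have hY1 : ‖Y‖ₑ ≤ 1 := by
    rw [← ofReal_norm, hY, norm_smul, norm_inv, Complex.norm_real, norm_norm,
      inv_mul_cancel₀ hX0, ENNReal.ofReal_one]
  have h1 : ‖amp n Φ Y‖ₑ ≤ cbNorm Φ :=
    le_iSup₂_of_le n hn (le_iSup₂_of_le Y hY1 le_rfl)
  have h2 : ‖amp n Φ X‖ₑ = ‖X‖ₑ * ‖amp n Φ Y‖ₑ := by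
    conv_lhs => rw [hXY, map_smul, enorm_smul]
    congr 1
    rw [← ofReal_norm, ← ofReal_norm, Complex.norm_real, norm_norm]
  rw [h2, mul_comm]
  gcongr

end Amp

/-! ### The Lipschitz norm controls the operator norm -/

section Main

variable {n d : ℕ} {ι : Type*} {a : ι → Mat d}

/-- The relative entropy of an invertible state is at most `log Ind`. The positive part of `log Ind`
loses nothing here, and an infinite index is allowed. -/
theorem ofReal_relEnt_le_log_index (ha : ∀ j, (a j).IsHermitian) (hn : 1 ≤ n)
    {ρ : MatAmp n d} (hρ : ρ.PosDef) (hρ1 : ρ.trace = 1) :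
    ENNReal.ofReal (relEnt ρ (amp n (condExp (commutant (Set.range a))) ρ)) ≤
      (ENNReal.log (indexCb (commutant (Set.range a)))).toENNReal := by
  have hσ := (isCondExp_amp (n := n) ha).posDef (isHermitian_ampJump ha) hρ
  set D := relEnt ρ (amp n (condExp (commutant (Set.range a))) ρ) with hD
  have hexp : ENNReal.ofReal (Real.exp D) ≤ indexCb (commutant (Set.range a)) := by
    by_contra! hlt
    have h1 := lt_of_le_of_lt (le_iSup₂_of_le (f := fun (n : ℕ) (_ : 1 ≤ n) =>
      ⨅ (α : ℝ) (_ : 0 < α) (_ : ∀ ρ : MatAmp n d, ρ.PosSemidef →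
        ((α : ℂ) • amp n (condExp (commutant (Set.range a))) ρ - ρ).PosSemidef),
        ENNReal.ofReal α) n hn le_rfl) hlt
    simp only [iInf_lt_iff] at h1
    obtain ⟨α, hα, hαρ, hαD⟩ := h1
    have h2 : ρ ≤ α • amp n (condExp (commutant (Set.range a))) ρ := by
      rw [Matrix.le_iff, ← Complex.coe_smul]
      exact hαρ ρ hρ.posSemidef
    have h3 := relEnt_le_log hρ hσ hρ1 hα h2
    rw [ENNReal.ofReal_lt_ofReal_iff (Real.exp_pos D)] at hαD
    exact absurd hαD (not_lt.2 ((Real.le_log_iff_exp_le hα).1 h3))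
  have h1 := ENNReal.log_monotone hexp
  rw [ENNReal.log_ofReal_of_pos (Real.exp_pos D), Real.log_exp] at h1
  have h2 := EReal.toENNReal_le_toENNReal h1
  rwa [EReal.toENNReal_of_ne_top (EReal.coe_ne_top D), EReal.toReal_coe] at h2

variable [Fintype ι]

theorem relEnt_expEnd_le_of_satisfiesCLSI (ha : ∀ j, (a j).IsHermitian) (hn : 1 ≤ n)
    {ρ : MatAmp n d} (hρ : ρ.PosDef) (hρ1 : ρ.trace = 1) {r : ℝ}
    (hr : SatisfiesCLSI (lindbladian a) (condExp (commutant (Set.range a))) r)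
    {s : ℝ} (hs : 0 ≤ s) :
    relEnt (expEnd (lind (ampJump n a)) s ρ) (amp n (condExp (commutant (Set.range a))) ρ) ≤
      Real.exp (-(r * s)) * relEnt ρ (amp n (condExp (commutant (Set.range a))) ρ) := by
  have hσ := (isCondExp_amp (n := n) ha).posDef (isHermitian_ampJump ha) hρ
  have h := hr n hn s hs ρ ⟨hρ.posSemidef, hρ1⟩
  rw [amp_semigroup, relEntropy_eq_relEnt _ hσ, relEntropy_eq_relEnt _ hσ, ← EReal.coe_mul,
    EReal.coe_le_coe_iff] at h
  exact h

/-- The transport inequality optimised over the admissible decay rates. It is stated with the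
relative entropy of `ρ`, which is finite, so that the quotient is meaningful also when the index
or the rate is infinite. -/
theorem ofReal_sq_trace_mul_le (ha : ∀ j, (a j).IsHermitian) (hn : 1 ≤ n) {X : MatAmp n d}
    (hXs : IsSelfAdjoint X) (hX : ∀ j, ‖ampJump n a j * X - X * ampJump n a j‖ ≤ 1)
    (hX0 : amp n (condExp (commutant (Set.range a))) X = 0)
    {ρ : MatAmp n d} (hρ : ρ.PosDef) (hρ1 : ρ.trace = 1) :
    ENNReal.ofReal ((X * ρ).trace.re ^ 2) ≤ 4 * ((Fintype.card ι : ℝ≥0∞) *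
      ENNReal.ofReal (relEnt ρ (amp n (condExp (commutant (Set.range a))) ρ)) /
        clsi (lindbladian a) (condExp (commutant (Set.range a)))) := by
  have hE := isCondExp_amp (n := n) ha
  have hb := isHermitian_ampJump (n := n) ha
  have hσ := hE.posDef hb hρ
  set σ := amp n (condExp (commutant (Set.range a))) ρ with hσdef
  have hσ1 : σ.trace = 1 := by rw [hσdef, hE.trace_apply, hρ1]
  have hσb : ∀ j, Commute (ampJump n a j) σ := hE.commute ρ
  have hXy : ∀ y, (∀ j, Commute (ampJump n a j) y) → (X * y).trace = 0 := fun y hy => by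
    rw [← hE.trace_mul X y hy, hX0, zero_mul, Matrix.trace_zero]
  have hXσ : (X * σ).trace = 0 := hXy σ hσb
  set D := relEnt ρ σ with hD
  have hD0 : 0 ≤ D := relEnt_nonneg hρ hσ hρ1 hσ1
  by_cases hzero : (Fintype.card ι : ℝ≥0∞) * ENNReal.ofReal D = 0
  · -- Without jump operators, or if `ρ` is invariant, the trace vanishes.
    have hw : (X * ρ).trace.re ^ 2 ≤ 0 := by
      rcases mul_eq_zero.1 hzero with h | h
      · have : IsEmpty ι := Fintype.card_eq_zero_iff.1 (by exact_mod_cast h)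
        rw [hXy ρ fun j => isEmptyElim j]
        simp
      · have hD' : D ≤ 0 := ENNReal.ofReal_eq_zero.1 h
        have h1 : (X * ρ).trace.re = (X * (ρ - σ)).trace.re := by
          rw [mul_sub, Matrix.trace_sub, hXσ, sub_zero]
        have h2 := sq_dist_le_relEntropy hρ hσ hρ1 hσ1
        have h3 := trace_mul_sq_le hXs (hρ.1.isSelfAdjoint.sub hσ.1.isSelfAdjoint)
        have h4 : ((ρ - σ) * (ρ - σ)).trace.re ≤ 0 := by
          have : D = (ρ * (cfc Real.log ρ - cfc Real.log σ)).trace.re := rfl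
          linarith
        rw [h1]
        exact h3.trans (mul_nonpos_of_nonneg_of_nonpos (trace_mul_self_nonneg hXs) h4)
    rw [ENNReal.ofReal_eq_zero.2 hw]
    exact zero_le
  have htop : 4 * ((Fintype.card ι : ℝ≥0∞) * ENNReal.ofReal D) ≠ ⊤ :=
    ENNReal.mul_ne_top (by norm_num)
      (ENNReal.mul_ne_top (ENNReal.natCast_ne_top _) ENNReal.ofReal_ne_top)
  rw [← mul_div_assoc, ENNReal.le_div_iff_mul_le (Or.inr (mul_ne_zero (by norm_num) hzero))
    (Or.inr htop), clsi, ENNReal.mul_iSup]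
  refine iSup_le fun r => ?_
  rw [ENNReal.mul_iSup]
  refine iSup_le fun hr => ?_
  rw [ENNReal.mul_iSup]
  refine iSup_le fun hrS => ?_
  have h := sq_trace_mul_le_of_decay hb hρ hσ hρ1 hσ1 hσb hXs hX hXσ hr
    fun s hs => relEnt_expEnd_le_of_satisfiesCLSI ha hn hρ hρ1 hrS hs
  rw [le_div_iff₀ hr] at h
  rw [← ENNReal.ofReal_mul (sq_nonneg _)]
  refine (ENNReal.ofReal_le_ofReal h).trans (le_of_eq ?_)
  rw [mul_assoc, ENNReal.ofReal_mul (by norm_num), ENNReal.ofReal_mul (by positivity),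
    ENNReal.ofReal_natCast]
  norm_num [hD]

/-- The bound `2 √(|Δ| log Ind / CLSI)` on the operator norm of a self-adjoint Lipschitz element in
the kernel of the conditional expectation. Invertible states suffice to detect the order, hence the
norm of a self-adjoint matrix. -/
theorem enorm_le_of_isSelfAdjoint (ha : ∀ j, (a j).IsHermitian) (hn : 1 ≤ n) {X : MatAmp n d}
    (hXs : IsSelfAdjoint X) (hX : ∀ j, ‖ampJump n a j * X - X * ampJump n a j‖ ≤ 1)
    (hX0 : amp n (condExp (commutant (Set.range a))) X = 0) :
    ‖X‖ₑ ≤ 2 * ((Fintype.card ι : ℝ≥0∞) *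
      (ENNReal.log (indexCb (commutant (Set.range a)))).toENNReal /
        clsi (lindbladian a) (condExp (commutant (Set.range a)))) ^ (1 / 2 : ℝ) := by
  set Q := (Fintype.card ι : ℝ≥0∞) *
      (ENNReal.log (indexCb (commutant (Set.range a)))).toENNReal /
        clsi (lindbladian a) (condExp (commutant (Set.range a))) with hQ
  by_cases hQtop : Q = ⊤
  · rw [hQtop, ENNReal.top_rpow_of_pos (by norm_num), ENNReal.mul_top (by norm_num)]
    exact le_top
  set K := 2 * √Q.toReal with hK
  have hK0 : 0 ≤ K := by positivity
  have hstate : ∀ ρ : MatAmp n d, ρ.PosDef → ρ.trace = 1 → |(X * ρ).trace.re| ≤ K :=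
    fun ρ hρ hρ1 => by
      have h1 : ENNReal.ofReal ((X * ρ).trace.re ^ 2) ≤ 4 * Q := by
        refine (ofReal_sq_trace_mul_le ha hn hXs hX hX0 hρ hρ1).trans ?_
        rw [hQ]
        gcongr
        exact ofReal_relEnt_le_log_index ha hn hρ hρ1
      rw [ENNReal.ofReal_le_iff_le_toReal (ENNReal.mul_ne_top (by norm_num) hQtop),
        ENNReal.toReal_mul] at h1
      refine abs_le_of_sq_le_sq (h1.trans (le_of_eq ?_)) hK0
      rw [hK, mul_pow, Real.sq_sqrt ENNReal.toReal_nonneg]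
      norm_num
  have hpos : ∀ ρ : MatAmp n d, ρ.PosDef → |(X * ρ).trace.re| ≤ K * ρ.trace.re := fun ρ hρ => by
    cases isEmpty_or_nonempty (Fin n × Fin d)
    · simp [Subsingleton.elim ρ 0]
    have ht := Complex.lt_def.1 hρ.trace_pos
    set τ := ρ.trace.re with hτ
    have ht0 : 0 < τ := ht.1
    have hτ' : ρ.trace = (τ : ℂ) := Complex.ext rfl ht.2.symm
    have h1 := hstate (τ⁻¹ • ρ) (hρ.smul (inv_pos.2 ht0)) (by
      rw [Matrix.trace_smul, hτ', Complex.real_smul, Complex.ofReal_inv,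
        inv_mul_cancel₀ (by exact_mod_cast ht0.ne')])
    rw [mul_smul_comm, Matrix.trace_smul, Complex.smul_re, smul_eq_mul, abs_mul,
      abs_of_pos (inv_pos.2 ht0), inv_mul_le_iff₀ ht0] at h1
    linarith
  have htr : ∀ ρ : MatAmp n d, (algebraMap ℝ _ K * ρ).trace.re = K * ρ.trace.re := fun ρ => by
    rw [Algebra.algebraMap_eq_smul_one, smul_mul_assoc, one_mul, Matrix.trace_smul,
      Complex.smul_re, smul_eq_mul]
  have hKs : IsSelfAdjoint (algebraMap ℝ (MatAmp n d) K) := IsSelfAdjoint.algebraMap _ (.all _)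
  have hle : ‖X‖ ≤ K := by
    refine norm_le_of_neg_le_of_le hXs hK0 ?_ ?_
    · rw [neg_le_iff_add_nonneg']
      refine nonneg_of_forall_posDef (hKs.add hXs) fun ρ hρ => ?_
      rw [add_mul, Matrix.trace_add, Complex.add_re, htr]
      linarith [neg_le_of_abs_le (hpos ρ hρ)]
    · rw [← sub_nonneg]
      refine nonneg_of_forall_posDef (hKs.sub hXs) fun ρ hρ => ?_
      rw [sub_mul, Matrix.trace_sub, Complex.sub_re, htr]
      linarith [le_of_abs_le (hpos ρ hρ)]
  rw [← ofReal_norm]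
  refine (ENNReal.ofReal_le_ofReal hle).trans (le_of_eq ?_)
  rw [hK, ENNReal.ofReal_mul (by norm_num), Real.sqrt_eq_rpow,
    ← ENNReal.ofReal_rpow_of_nonneg ENNReal.toReal_nonneg (by norm_num),
    ENNReal.ofReal_toReal hQtop]
  norm_num

theorem enorm_amp_semigroup_sub_le (ha : ∀ j, (a j).IsHermitian) (hn : 1 ≤ n) {X : MatAmp n d}
    (hXs : IsSelfAdjoint X) {t : ℝ} (ht : 0 ≤ t) :
    ‖amp n (semigroup (lindbladian a) t) X - X‖ₑ ≤
      cbNorm (lindbladian a) * ‖X‖ₑ * ENNReal.ofReal t := by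
  rw [amp_semigroup, ← ofReal_norm]
  refine (ENNReal.ofReal_le_ofReal
    (norm_expEnd_lind_sub_le (isHermitian_ampJump ha) ht hXs)).trans ?_
  rw [ENNReal.ofReal_mul (norm_nonneg _), ofReal_norm, ← amp_lindbladian]
  gcongr
  exact enorm_amp_le _ hn X

/-- The bound for a self-adjoint part `c X + (c X)^*`, `|c| = 1/2`, of a Lipschitz element `X` in
the kernel of the conditional expectation. -/
theorem enorm_amp_semigroup_sub_selfAdjoint_part_le (ha : ∀ j, (a j).IsHermitian) (hn : 1 ≤ n)
    {X : MatAmp n d} (hX : ∀ j, ‖ampJump n a j * X - X * ampJump n a j‖ ≤ 1)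
    (hX0 : amp n (condExp (commutant (Set.range a))) X = 0) {c : ℂ} (hc : ‖c‖ = 1 / 2)
    {t : ℝ} (ht : 0 ≤ t) :
    ‖amp n (semigroup (lindbladian a) t) (c • X + star (c • X)) - (c • X + star (c • X))‖ₑ ≤
      cbNorm (lindbladian a) * (2 * ((Fintype.card ι : ℝ≥0∞) *
        (ENNReal.log (indexCb (commutant (Set.range a)))).toENNReal /
          clsi (lindbladian a) (condExp (commutant (Set.range a)))) ^ (1 / 2 : ℝ)) *
        ENNReal.ofReal t := by
  have hb := isHermitian_ampJump (n := n) ha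
  have hs : IsSelfAdjoint (c • X + star (c • X)) := by
    rw [isSelfAdjoint_iff, star_add, star_star, add_comm]
  refine (enorm_amp_semigroup_sub_le ha hn hs ht).trans ?_
  gcongr
  refine enorm_le_of_isSelfAdjoint ha hn hs (fun j => ?_) ?_
  · set B := ampJump n a j with hB
    have hBs : star B = B := hb j
    have h1 : B * (c • X + star (c • X)) - (c • X + star (c • X)) * B =
        c • (B * X - X * B) - star (c • (B * X - X * B)) := by
      simp only [smul_sub, star_sub, star_smul, star_mul, hBs, mul_add, add_mul, mul_smul_comm,
        smul_mul_assoc]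
      abel
    have h2 : ‖c • (B * X - X * B)‖ ≤ 1 / 2 := by
      rw [norm_smul, hc]
      linarith [hX j]
    rw [h1]
    refine (norm_sub_le _ _).trans ?_
    rw [norm_star]
    linarith
  · rw [map_add, (isCondExp_amp ha).star_apply hb, map_smul, hX0, smul_zero, star_zero, add_zero]

end Main

end QTransport

open QTransport in
theorem mainTheorem3 {d : ℕ} {ι : Type*} [Fintype ι] (a : ι → Mat d)
    (ha : ∀ j, (a j).IsHermitian) (t : ℝ) (ht : 0 ≤ t) :
    complexityCb (Set.range a) (semigroup (lindbladian a) t) ≤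
      4 * (2 * (Fintype.card ι : ℝ≥0∞) *
            (ENNReal.log (indexCb (commutant (Set.range a)))).toENNReal /
            clsi (lindbladian a) (condExp (commutant (Set.range a)))) ^ (1 / 2 : ℝ) *
        cbNorm (lindbladian a) * ENNReal.ofReal t := by
  refine iSup₂_le fun n hn => iSup_le fun X => iSup₂_le fun hX0 hXL => ?_
  have hX : ∀ j, ‖ampJump n a j * X - X * ampJump n a j‖ ≤ 1 := fun j => by
    have h : ‖ampJump n a j * X - X * ampJump n a j‖ₑ ≤ 1 :=
      (le_iSup₂_of_le (f := fun s (_ : s ∈ Set.range a) =>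
        ‖((1 : Mat n) ⊗ₖ s) * X - X * ((1 : Mat n) ⊗ₖ s)‖ₑ) (a j) ⟨j, rfl⟩ le_rfl).trans hXL
    rwa [← ofReal_norm, ENNReal.ofReal_le_one] at h
  -- Contractivity and the transport bound are available for self-adjoint elements, so `X` is split
  -- into its real part `A` and imaginary part `B`.
  set A : MatAmp n d := (1 / 2 : ℂ) • X + star ((1 / 2 : ℂ) • X) with hA
  set B : MatAmp n d := (-Complex.I / 2) • X + star ((-Complex.I / 2) • X) with hB
  have hAB : X = A + Complex.I • B := by
    rw [hA, hB, star_smul, star_smul, smul_add, smul_smul, smul_smul]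
    have h1 : Complex.I * (-Complex.I / 2) = 1 / 2 := by
      rw [mul_div_assoc', mul_neg, Complex.I_mul_I, neg_neg]
    have h2 : star (1 / 2 : ℂ) = 1 / 2 := by simp
    have h3 : Complex.I * star (-Complex.I / 2) = -(1 / 2) := by
      have : star (-Complex.I / 2) = Complex.I / 2 := by simp
      rw [this, mul_div_assoc', Complex.I_mul_I]
      ring
    rw [h1, h2, h3, neg_smul, add_add_add_comm, add_neg_cancel, add_zero, ← add_smul]
    norm_num
  have hsplit : amp n (traceDual (semigroup (lindbladian a) t) - LinearMap.id) X =
      (amp n (semigroup (lindbladian a) t) A - A) +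
        Complex.I • (amp n (semigroup (lindbladian a) t) B - B) := by
    have h1 : amp n (traceDual (semigroup (lindbladian a) t) - LinearMap.id) X =
        amp n (semigroup (lindbladian a) t) X - X := by
      rw [traceDual_semigroup]
      rfl
    have h2 : amp n (semigroup (lindbladian a) t) X - X =
        amp n (semigroup (lindbladian a) t) (A + Complex.I • B) - (A + Complex.I • B) := by
      rw [← hAB]
    rw [h1, h2, smul_sub, map_add, map_smul]
    abel
  have hIA := enorm_amp_semigroup_sub_selfAdjoint_part_le ha hn hX hX0 (c := 1 / 2) (by norm_num) ht
  have hIB := enorm_amp_semigroup_sub_selfAdjoint_part_le ha hn hX hX0 (c := -Complex.I / 2)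
    (by simp) ht
  rw [hsplit]
  refine (enorm_add_le _ _).trans ?_
  have hI : ‖Complex.I‖ₑ = 1 := by rw [← ofReal_norm]; simp
  rw [enorm_smul, hI, one_mul]
  refine (add_le_add hIA hIB).trans ?_
  have hmono : ((Fintype.card ι : ℝ≥0∞) *
        (ENNReal.log (indexCb (commutant (Set.range a)))).toENNReal /
          clsi (lindbladian a) (condExp (commutant (Set.range a)))) ^ (1 / 2 : ℝ) ≤
      (2 * (Fintype.card ι : ℝ≥0∞) *
        (ENNReal.log (indexCb (commutant (Set.range a)))).toENNReal /
          clsi (lindbladian a) (condExp (commutant (Set.range a)))) ^ (1 / 2 : ℝ) := by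
    gcongr
    rw [mul_comm 2]
    exact le_mul_of_one_le_right' (by norm_num)
  refine le_trans (le_of_eq ?_)
    (mul_le_mul_left (mul_le_mul_left (mul_le_mul_right hmono 4) (cbNorm (lindbladian a)))
      (ENNReal.ofReal t))
  ring
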